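/- **Setting.** Let $(\mathcal C,\mathbb E,\mathfrak s)$ be a small extriangulated category (in the sense of Nakaoka and Palu), equipped with a system of higher extension groups, that is, additive bifunctors $\mathbb E^i:\mathcal C^{op}\times\mathcal C\to \mathrm{Ab}$ ($i\ge 1$) with $\mathbb E^1=\mathbb E$ such that * every $\mathbb E$-triangle $A\xrightarrow{x}B\xrightarrow{y}C\overset{\delta}{\dashrightarrow}$ and every $i\geq 1$ come with natural transformations $\partial^i_\delta:\mathbb E^i(A,-)\to\mathbb E^{i+1}(C,-)$ and $\Delta^i_\delta:\mathbb E^i(-,C)\to\mathbb E^{i+1}(-,A)$ for which the sequences $\mathbb E^i(C,-)\to\mathbb E^i(B,-)\to\mathbb E^i(A,-)\xrightarrow{\partial^i_\delta}\mathbb E^{i+1}(C,-)$ and $\mathbb E^i(-,A)\to\mathbb E^i(-,B)\to\mathbb E^i(-,C)\xrightarrow{\Delta^i_\delta}\mathbb E^{i+1}(-,A)$ are exact, and which are compatible with morphisms of $\mathbb E$-triangles; * $\mathbb E^i(f,-)=0$ for every $\mathbb E$-projective morphism $f$ (i.e. $\mathbb E(f,-)=0$), and $\mathbb E^i(-,g)=0$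 for every $\mathbb E$-injective morphism $g$ (i.e. $\mathbb E(-,g)=0$). Let $n\ge 0$ and let $\mathcal X\subseteq\mathcal C$ be a full subcategory such that $\mathcal X=\mathrm{free}(\mathcal X)$, the class of all finite coproducts of objects of $\mathcal X$, and which is $(n+2)$-rigid: $\mathbb E^i(\mathcal X,\mathcal X)=0$ for $1\le i\le n+1$. For $m\geq 0$ let $\mathcal X_m^\vee$ (resp. $\mathcal X_m^\wedge$) be the full subcategory of the objects of $\mathcal X$-coresolution dimension (resp. $\mathcal X$-resolution dimension) at most $m$, where finite (co)resolutions are spliced from conflations. Let $\underline{\mathcal X_n^\vee}$ be the quotient of $\mathcal X_n^\vee$ by the ideal of its morphisms $f$ with $\mathbb E(f,-)=0$, and $\overline{\mathcal X_n^\wedge}$ the quotient of $\mathcal X_n^\wedge$ by the ideal of its morphisms $g$ with $\mathbb E(-,g)=0$. For a preadditive category $\mathcal Z$ let $\mathrm{fp}\,\mathcal Z$ (resp. $\mathcal Z\,\mathrm{fp}$) be the category of finitely presented additive contravariant (resp. covariant) functors $\mathcal Z\to\mathrm{Ab}$, i.e. of those which are cokernels of a morphism between finite coproducts of representable functors. Finally,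 $[\mathcal X]$ denotes the ideal of the morphisms that factor through an object of $\mathcal X$. **Theorem.** 1. The assignment $M\mapsto\mathbb E(-,M)|_{\mathcal X_n^\vee}$ induces a fully faithful functor $\mathbb F:\mathcal X_{n+1}^\vee/[\mathcal X]\to\mathrm{fp}\,\underline{\mathcal X_n^\vee}$. Suppose that $\mathcal X_n^\vee$ has enough $\mathbb E$-projective morphisms from $\mathcal X$ (every $C\in\mathcal X_n^\vee$ admits a deflation $f:X\to C$ with $X\in\mathcal X$ and $\mathbb E(f,-)=0$) and that $\mathbb E(\mathcal X_n^\vee,\mathcal X_n^\vee)=0$. Then $\mathbb F$ is an equivalence of categories. 2. Dually, the assignment $M\mapsto\mathbb E(M,-)|_{\mathcal X_n^\wedge}$ induces a fully faithful functor $\mathbb K:(\mathcal X_{n+1}^\wedge/[\mathcal X])^{op}\to\overline{\mathcal X_n^\wedge}\,\mathrm{fp}$. Suppose that $\mathcal X_n^\wedge$ has enough $\mathbb E$-injective morphisms to $\mathcal X$ (every $C\in\mathcal X_n^\wedge$ admits an inflation $g:C\to X$ with $X\in\mathcal X$ and $\mathbb E(-,g)=0$) and that $\mathbb E(\mathcal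 X_n^\wedge,\mathcal X_n^\wedge)=0$. Then $\mathbb K$ is an equivalence of categories. -/

import Mathlib

open CategoryTheory CategoryTheory.Limits Opposite

universe v u

noncomputable section

namespace Extri

attribute [local instance] hasBinaryBiproducts_of_finite_biproducts

/-! ### Extensions and their realizations -/

section Extensions

variable {C : Type u} [Category.{v} C] (E : Cᵒᵖ ⥤ C ⥤ AddCommGrpCat.{v})

/-- The group `𝔼(X, A)` of `𝔼`-extensions of `X` by `A`. -/
abbrev Ext (X A : C) : Type v := ((E.obj (op X)).obj A : AddCommGrpCat.{v})

variable {E}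

/-- `a · δ = 𝔼(X, a)(δ)`. -/
def push {X A A' : C} (a : A ⟶ A') (δ : Ext E X A) : Ext E X A' :=
  ((E.obj (op X)).map a).hom δ

/-- `δ · c = 𝔼(c, A)(δ)`. -/
def pull {X X' A : C} (δ : Ext E X A) (c : X' ⟶ X) : Ext E X' A :=
  ((E.map c.op).app A).hom δ

end Extensions

section Sequences

variable {C : Type u} [Category.{v} C]

/-- Sequences `A ⟶ B ⟶ X` with fixed end terms `A` and `X`. -/
structure Seq (A X : C) where
  mid : C
  inl : A ⟶ mid
  out : mid ⟶ X

/-- Two sequences are equivalent if there is an isomorphism of the middle terms which is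
compatible with the identities of the end terms. -/
def Seq.Equivalent {A X : C} (S T : Seq A X) : Prop :=
  ∃ b : S.mid ≅ T.mid, S.inl ≫ b.hom = T.inl ∧ b.hom ≫ T.out = S.out

instance seqSetoid (A X : C) : Setoid (Seq A X) where
  r := Seq.Equivalent
  iseqv :=
    { refl := fun S => ⟨Iso.refl _, by simp, by simp⟩
      symm := by
        rintro S T ⟨b, h, k⟩
        exact ⟨b.symm, by simp [← h], by simp [← k]⟩
      trans := by
        rintro S T U ⟨b, h, k⟩ ⟨c, h', k'⟩
        exact ⟨b ≪≫ c, by simp [← h', ← h], by simp [← k, k']⟩ }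

/-- The equivalence class `[A ⟶ B ⟶ X]`. -/
def seqClass {A B X : C} (x : A ⟶ B) (y : B ⟶ X) : Quotient (seqSetoid A X) :=
  Quotient.mk _ ⟨B, x, y⟩

end Sequences

section Sum

variable {C : Type u} [Category.{v} C] [Preadditive C] [HasFiniteBiproducts C]
  {E : Cᵒᵖ ⥤ C ⥤ AddCommGrpCat.{v}}

/-- `δ ⊕ δ'`: the element of `𝔼(X ⊞ X', A ⊞ A')` whose components in
`𝔼(X, A)`, `𝔼(X, A')`, `𝔼(X', A)`, `𝔼(X', A')` are `δ`, `0`, `0`, `δ'`. -/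
def extSum {X A X' A' : C} (δ : Ext E X A) (δ' : Ext E X' A') : Ext E (X ⊞ X') (A ⊞ A') :=
  pull (push (biprod.inl : A ⟶ A ⊞ A') δ) (biprod.fst : X ⊞ X' ⟶ X) +
    pull (push (biprod.inr : A' ⟶ A ⊞ A') δ') (biprod.snd : X ⊞ X' ⟶ X')

end Sum

/-- An extriangulated category in the sense of Nakaoka and Palu: an additive category `C` with an
additive bifunctor `E` to abelian groups, and an additive realization `s` of `E` which satisfies
(ET3), (ET3)ᵒᵖ, (ET4) and (ET4)ᵒᵖ. The equation `s δ = seqClass x y` says that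
`A ⟶ B ⟶ X` (with maps `x` and `y`) realizes `δ`. -/
class ExtriangulatedCategory (C : Type u) [Category.{v} C] [Preadditive C]
    [HasFiniteBiproducts C] where
  /-- the bifunctor `𝔼`, contravariant in its first and covariant in its second variable -/
  E : Cᵒᵖ ⥤ C ⥤ AddCommGrpCat.{v}
  additive_right (X : Cᵒᵖ) : (E.obj X).Additive
  additive_left (A : C) : (E.flip.obj A).Additive
  /-- the realization `𝔰` -/
  s {X A : C} (δ : Ext E X A) : Quotient (seqSetoid A X)
  realization {X A X' A' B B' : C} (δ : Ext E X A) (δ' : Ext E X' A')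
    (x : A ⟶ B) (y : B ⟶ X) (x' : A' ⟶ B') (y' : B' ⟶ X')
    (hδ : s δ = seqClass x y) (hδ' : s δ' = seqClass x' y')
    (a : A ⟶ A') (c : X ⟶ X') (hac : push a δ = pull δ' c) :
    ∃ b : B ⟶ B', x ≫ b = a ≫ x' ∧ y ≫ c = b ≫ y'
  realization_zero (X A : C) :
    s (0 : Ext E X A) = seqClass (biprod.inl : A ⟶ A ⊞ X) (biprod.snd : A ⊞ X ⟶ X)
  realization_sum {X A X' A' B B' : C} (δ : Ext E X A) (δ' : Ext E X' A')
    (x : A ⟶ B) (y : B ⟶ X) (x' : A' ⟶ B') (y' : B' ⟶ X')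
    (hδ : s δ = seqClass x y) (hδ' : s δ' = seqClass x' y') :
    s (extSum δ δ') = seqClass (biprod.map x x') (biprod.map y y')
  et3 {X A X' A' B B' : C} (δ : Ext E X A) (δ' : Ext E X' A')
    (x : A ⟶ B) (y : B ⟶ X) (x' : A' ⟶ B') (y' : B' ⟶ X')
    (hδ : s δ = seqClass x y) (hδ' : s δ' = seqClass x' y')
    (a : A ⟶ A') (b : B ⟶ B') (hab : x ≫ b = a ≫ x') :
    ∃ c : X ⟶ X', push a δ = pull δ' c ∧ y ≫ c = b ≫ y'
  et3_op {X A X' A' B B' : C} (δ : Ext E X A) (δ' : Ext E X' A')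
    (x : A ⟶ B) (y : B ⟶ X) (x' : A' ⟶ B') (y' : B' ⟶ X')
    (hδ : s δ = seqClass x y) (hδ' : s δ' = seqClass x' y')
    (b : B ⟶ B') (c : X ⟶ X') (hbc : y ≫ c = b ≫ y') :
    ∃ a : A ⟶ A', push a δ = pull δ' c ∧ x ≫ b = a ≫ x'
  et4 {A B D M F : C} (δ : Ext E D A) (δ' : Ext E F B)
    (f : A ⟶ B) (f' : B ⟶ D) (g : B ⟶ M) (g' : M ⟶ F)
    (hδ : s δ = seqClass f f') (hδ' : s δ' = seqClass g g') :
    ∃ (N : C) (h' : M ⟶ N) (d : D ⟶ N) (e : N ⟶ F) (δ'' : Ext E N A),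
      g ≫ h' = f' ≫ d ∧ h' ≫ e = g' ∧
      s δ'' = seqClass (f ≫ g) h' ∧
      s (push f' δ') = seqClass d e ∧
      pull δ'' d = δ ∧
      push f δ'' = pull δ' e
  et4_op {D A B F M : C} (δ : Ext E B D) (δ' : Ext E M F)
    (f' : D ⟶ A) (f : A ⟶ B) (g' : F ⟶ B) (g : B ⟶ M)
    (hδ : s δ = seqClass f' f) (hδ' : s δ' = seqClass g' g) :
    ∃ (N : C) (d : D ⟶ N) (e : N ⟶ F) (h' : N ⟶ A) (δ'' : Ext E M N),
      d ≫ h' = f' ∧ h' ≫ f = e ≫ g' ∧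
      s δ'' = seqClass h' (f ≫ g) ∧
      s (pull δ g') = seqClass d e ∧
      δ' = push e δ'' ∧
      push d δ = pull δ'' g

open ExtriangulatedCategory

attribute [instance] ExtriangulatedCategory.additive_right ExtriangulatedCategory.additive_left

section Basic

variable {C : Type u} [Category.{v} C] [Preadditive C] [HasFiniteBiproducts C]
  [ExtriangulatedCategory C]

/-- `A ⟶ B ⟶ X` is a conflation. -/
def IsConflation {A B X : C} (x : A ⟶ B) (y : B ⟶ X) : Prop :=
  ∃ δ : Ext (E (C := C)) X A, s δ = seqClass x y

def IsInflation {A B : C} (x : A ⟶ B) : Prop :=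
  ∃ (X : C) (y : B ⟶ X), IsConflation x y

def IsDeflation {B X : C} (y : B ⟶ X) : Prop :=
  ∃ (A : C) (x : A ⟶ B), IsConflation x y

/-- `f` is an `𝔼`-projective morphism: `𝔼(f, -) = 0`. -/
def IsProjMor {X Y : C} (f : X ⟶ Y) : Prop :=
  ∀ (A : C) (δ : Ext (E (C := C)) Y A), pull δ f = 0

/-- `g` is an `𝔼`-injective morphism: `𝔼(-, g) = 0`. -/
def IsInjMor {A B : C} (g : A ⟶ B) : Prop :=
  ∀ (X : C) (δ : Ext (E (C := C)) X A), push g δ = 0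

/-- `free(P)`: the finite (possibly empty) coproducts of objects of `P`. -/
def free (P : ObjectProperty C) : ObjectProperty C := fun Y =>
  ∃ (k : ℕ) (Z : Fin k → C), (∀ i, P (Z i)) ∧ Nonempty (Y ≅ ⨁ Z)

/-- `Y` has a `P`-coresolution `0 ⟶ Y ⟶ Y₀ ⟶ ⋯ ⟶ Y₋ₘ ⟶ 0` of length `m`, cut into conflations. -/
def HasCoresolution (P : ObjectProperty C) : ℕ → C → Prop
  | 0, Y => ∃ X : C, P X ∧ Nonempty (Y ≅ X)
  | m + 1, Y => ∃ (X Z : C) (x : Y ⟶ X) (y : X ⟶ Z),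
      P X ∧ IsConflation x y ∧ HasCoresolution P m Z

/-- `Y` has a `P`-resolution `0 ⟶ Xₘ ⟶ ⋯ ⟶ X₀ ⟶ Y ⟶ 0` of length `m`, cut into conflations. -/
def HasResolution (P : ObjectProperty C) : ℕ → C → Prop
  | 0, Y => ∃ X : C, P X ∧ Nonempty (X ≅ Y)
  | m + 1, Y => ∃ (Z X : C) (x : Z ⟶ X) (y : X ⟶ Y),
      P X ∧ IsConflation x y ∧ HasResolution P m Z

/-- The class `P_n^∨` of the objects of `P`-coresolution dimension at most `n`. -/
def vee (P : ObjectProperty C) (n : ℕ) : ObjectProperty C := fun Y =>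
  ∃ m ≤ n, HasCoresolution P m Y

/-- The class `P_n^∧` of the objects of `P`-resolution dimension at most `n`. -/
def wedge (P : ObjectProperty C) (n : ℕ) : ObjectProperty C := fun Y =>
  ∃ m ≤ n, HasResolution P m Y

/-- `Q` has enough `𝔼`-projective morphisms from `P`. -/
def EnoughProjMor (Q P : ObjectProperty C) : Prop :=
  ∀ Y : C, Q Y → ∃ (X : C) (f : X ⟶ Y), P X ∧ IsDeflation f ∧ IsProjMor f

/-- `Q` has enough `𝔼`-injective morphisms to `P`. -/
def EnoughInjMor (Q P : ObjectProperty C) : Prop :=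
  ∀ Y : C, Q Y → ∃ (X : C) (g : Y ⟶ X), P X ∧ IsInflation g ∧ IsInjMor g

/-- `𝔼(P, Q) = 0`. -/
def ExtVanish (P Q : ObjectProperty C) : Prop :=
  ∀ X A : C, P X → Q A → ∀ δ : Ext (E (C := C)) X A, δ = 0

/-- The relation on morphisms of the full subcategory `Q` whose quotient is `Q/[P]`: the difference
of the two morphisms factors through an object of `P`. -/
def factorRel (Q P : ObjectProperty C) : HomRel Q.FullSubcategory := fun M N f g =>
  ∃ (X : C) (a : M.obj ⟶ X) (b : X ⟶ N.obj), P X ∧ f.hom - g.hom = a ≫ b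

end Basic

/-! ### Higher extension groups -/

/-- A system of higher `𝔼`-extension groups on `C`. The bifunctor `ext i` is `𝔼^{i+1}`.
The connecting maps `∂_δ` and `Δ_δ` are part of the data. Since a pair `(a, c)` with
`a · δ = δ' · c` always extends to a morphism of `𝔼`-triangles, and every morphism of
`𝔼`-triangles is of this form, `conn_left_naturality` and `conn_right_naturality` express the
compatibility of the connecting maps with all morphisms of `𝔼`-triangles. -/
structure HigherExtensions (C : Type u) [Category.{v} C] [Preadditive C] [HasFiniteBiproducts C]
    [ExtriangulatedCategory C] where
  ext : ℕ → (Cᵒᵖ ⥤ C ⥤ AddCommGrpCat.{v})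
  additive_right (i : ℕ) (X : Cᵒᵖ) : ((ext i).obj X).Additive
  additive_left (i : ℕ) (A : C) : ((ext i).flip.obj A).Additive
  ext_zero : ext 0 = E
  /-- `∂_δ : 𝔼^{i+1}(A, -) ⟶ 𝔼^{i+2}(X, -)` -/
  connLeft {X A : C} (δ : Ext (E (C := C)) X A) (i : ℕ) :
    (ext i).obj (op A) ⟶ (ext (i + 1)).obj (op X)
  /-- `Δ_δ : 𝔼^{i+1}(-, X) ⟶ 𝔼^{i+2}(-, A)` -/
  connRight {X A : C} (δ : Ext (E (C := C)) X A) (i : ℕ) :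
    (ext i).flip.obj X ⟶ (ext (i + 1)).flip.obj A
  exact_left_mid {A B X : C} (δ : Ext (E (C := C)) X A) (x : A ⟶ B) (y : B ⟶ X)
    (hδ : s δ = seqClass x y) (i : ℕ) (W : C) :
    Function.Exact (((ext i).map y.op).app W) (((ext i).map x.op).app W)
  exact_left_end {A B X : C} (δ : Ext (E (C := C)) X A) (x : A ⟶ B) (y : B ⟶ X)
    (hδ : s δ = seqClass x y) (i : ℕ) (W : C) :
    Function.Exact (((ext i).map x.op).app W) ((connLeft δ i).app W)
  exact_right_mid {A B X : C} (δ : Ext (E (C := C)) X A) (x : A ⟶ B) (y : B ⟶ X)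
    (hδ : s δ = seqClass x y) (i : ℕ) (W : C) :
    Function.Exact (((ext i).obj (op W)).map x) (((ext i).obj (op W)).map y)
  exact_right_end {A B X : C} (δ : Ext (E (C := C)) X A) (x : A ⟶ B) (y : B ⟶ X)
    (hδ : s δ = seqClass x y) (i : ℕ) (W : C) :
    Function.Exact (((ext i).obj (op W)).map y) ((connRight δ i).app (op W))
  conn_left_naturality {X A X' A' : C} (δ : Ext (E (C := C)) X A) (δ' : Ext (E (C := C)) X' A')
    (a : A ⟶ A') (c : X ⟶ X') (hac : push a δ = pull δ' c) (i : ℕ) :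
    (ext i).map a.op ≫ connLeft δ i = connLeft δ' i ≫ (ext (i + 1)).map c.op
  conn_right_naturality {X A X' A' : C} (δ : Ext (E (C := C)) X A) (δ' : Ext (E (C := C)) X' A')
    (a : A ⟶ A') (c : X ⟶ X') (hac : push a δ = pull δ' c) (i : ℕ) :
    connRight δ i ≫ (ext (i + 1)).flip.map a = (ext i).flip.map c ≫ connRight δ' i
  proj_mor_zero {X Y : C} (f : X ⟶ Y) (hf : IsProjMor f) (i : ℕ) : (ext i).map f.op = 0
  inj_mor_zero {A B : C} (g : A ⟶ B) (hg : IsInjMor g) (i : ℕ) : (ext i).flip.map g = 0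

/-- `P` is `(n+2)`-rigid: `𝔼^j(P, P) = 0` for `1 ≤ j ≤ n + 1`. -/
def IsRigid {C : Type u} [Category.{v} C] [Preadditive C] [HasFiniteBiproducts C]
    [ExtriangulatedCategory C] (H : HigherExtensions C) (n : ℕ) (P : ObjectProperty C) : Prop :=
  ∀ i ≤ n, ∀ X A : C, P X → P A → ∀ η : Ext (H.ext i) X A, η = 0

/-! ### Modules over a preadditive category -/

section Modules

variable (Z : Type u) [Category.{v} Z] [Preadditive Z]

/-- Finitely presented right `Z`-modules: the additive functors `Zᵒᵖ ⥤ Ab` which are cokernels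
of a morphism between finite coproducts of representable functors. -/
def fpRight : ObjectProperty (Zᵒᵖ ⥤ AddCommGrpCat.{v}) := fun G =>
  G.Additive ∧ ∃ (k l : ℕ) (Y : Fin k → Z) (W : Fin l → Z)
    (α : (∐ fun i => preadditiveYoneda.obj (Y i)) ⟶ (∐ fun j => preadditiveYoneda.obj (W j)))
    (p : (∐ fun j => preadditiveYoneda.obj (W j)) ⟶ G) (w : α ≫ p = 0),
    Nonempty (IsColimit (CokernelCofork.ofπ p w))

/-- Finitely presented left `Z`-modules: the additive functors `Z ⥤ Ab` which are cokernels
of a morphism between finite coproducts of corepresentable functors. -/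
def fpLeft : ObjectProperty (Z ⥤ AddCommGrpCat.{v}) := fun G =>
  G.Additive ∧ ∃ (k l : ℕ) (Y : Fin k → Z) (W : Fin l → Z)
    (α : (∐ fun i => preadditiveCoyoneda.obj (op (Y i))) ⟶
      (∐ fun j => preadditiveCoyoneda.obj (op (W j))))
    (p : (∐ fun j => preadditiveCoyoneda.obj (op (W j))) ⟶ G) (w : α ≫ p = 0),
    Nonempty (IsColimit (CokernelCofork.ofπ p w))

end Modules

/-! ### Stable and costable categories -/

section Stable

variable {C : Type u} [Category.{v} C] [Preadditive C] [HasFiniteBiproducts C]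
  [ExtriangulatedCategory C]

lemma pull_add {X Y A : C} (δ : Ext (E (C := C)) Y A) (f g : X ⟶ Y) :
    pull δ (f + g) = pull δ f + pull δ g := by
  have h := ((E (C := C)).flip.obj A).map_add (f := f.op) (g := g.op)
  exact congrArg (fun φ => φ.hom δ) h

lemma push_add {X A B : C} (δ : Ext (E (C := C)) X A) (f g : A ⟶ B) :
    push (f + g) δ = push f δ + push g δ := by
  have h := ((E (C := C)).obj (op X)).map_add (f := f) (g := g)
  exact congrArg (fun φ => φ.hom δ) h

lemma pull_zero {X Y A : C} (δ : Ext (E (C := C)) Y A) : pull δ (0 : X ⟶ Y) = 0 := by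
  simpa using pull_add δ (0 : X ⟶ Y) 0

lemma push_zero {X A B : C} (δ : Ext (E (C := C)) X A) : push (0 : A ⟶ B) δ = 0 := by
  simpa using push_add δ (0 : A ⟶ B) 0

lemma pull_sub {X Y A : C} (δ : Ext (E (C := C)) Y A) (f g : X ⟶ Y) :
    pull δ (f - g) = pull δ f - pull δ g := by
  rw [eq_sub_iff_add_eq, ← pull_add, sub_add_cancel]

lemma push_sub {X A B : C} (δ : Ext (E (C := C)) X A) (f g : A ⟶ B) :
    push (f - g) δ = push f δ - push g δ := by
  rw [eq_sub_iff_add_eq, ← push_add, sub_add_cancel]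

lemma pull_comp {X Y Z A : C} (δ : Ext (E (C := C)) Z A) (f : X ⟶ Y) (g : Y ⟶ Z) :
    pull δ (f ≫ g) = pull (pull δ g) f := by
  simp [pull]

lemma push_comp {X A B D : C} (δ : Ext (E (C := C)) X A) (f : A ⟶ B) (g : B ⟶ D) :
    push (f ≫ g) δ = push g (push f δ) := by
  simp [push]

lemma push_pull {X Y A B : C} (δ : Ext (E (C := C)) Y A) (f : X ⟶ Y) (g : A ⟶ B) :
    push g (pull δ f) = pull (push g δ) f := by
  have h := ((E (C := C)).map f.op).naturality g
  exact congrArg (fun φ => φ.hom δ) h.symm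

lemma map_push_zero {X A B : C} (g : A ⟶ B) : push g (0 : Ext (E (C := C)) X A) = 0 := by
  simp [push]

lemma map_pull_zero {X Y A : C} (f : X ⟶ Y) : pull (0 : Ext (E (C := C)) Y A) f = 0 := by
  simp [pull]

variable (Q : ObjectProperty C)

/-- Two morphisms of `Q` are identified in the stable category when their difference is an
`𝔼`-projective morphism. -/
def stableRel : HomRel Q.FullSubcategory := fun _ _ f g => IsProjMor (f.hom - g.hom)

/-- Two morphisms of `Q` are identified in the costable category when their difference is an
`𝔼`-injective morphism. -/
def costableRel : HomRel Q.FullSubcategory := fun _ _ f g => IsInjMor (f.hom - g.hom)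

instance : Congruence (stableRel Q) where
  comp_left {X Y Z} f {g g'} h := fun A δ => by
    have := h A δ
    simp only [ObjectProperty.FullSubcategory.comp_hom, ← Preadditive.comp_sub] at this ⊢
    rw [pull_comp, this, map_pull_zero]
  comp_right {X Y Z} {f f'} g h := fun A δ => by
    simp only [ObjectProperty.FullSubcategory.comp_hom, ← Preadditive.sub_comp]
    rw [pull_comp, h]
  equivalence :=
    { refl := fun f A δ => by rw [sub_self, pull_zero]
      symm := fun {f g} h A δ => by
        have := h A δ
        rw [pull_sub, sub_eq_zero] at this ⊢
        exact this.symm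
      trans := fun {f g k} h h' A δ => by
        have := h A δ
        have := h' A δ
        rw [pull_sub, sub_eq_zero] at *
        simp_all }

instance : Congruence (costableRel Q) where
  comp_left {X Y Z} f {g g'} h := fun A δ => by
    simp only [ObjectProperty.FullSubcategory.comp_hom, ← Preadditive.comp_sub]
    rw [push_comp, h]
  comp_right {X Y Z} {f f'} g h := fun A δ => by
    simp only [ObjectProperty.FullSubcategory.comp_hom, ← Preadditive.sub_comp]
    rw [push_comp, h, map_push_zero]
  equivalence :=
    { refl := fun f A δ => by rw [sub_self, push_zero]
      symm := fun {f g} h A δ => by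
        have := h A δ
        rw [push_sub, sub_eq_zero] at this ⊢
        exact this.symm
      trans := fun {f g k} h h' A δ => by
        have := h A δ
        have := h' A δ
        rw [push_sub, sub_eq_zero] at *
        simp_all }

/-- The stable category of `Q`: the quotient of `Q` by the ideal of `𝔼`-projective morphisms. -/
abbrev StableCat : Type u := Quotient (stableRel Q)

/-- The costable category of `Q`: the quotient of `Q` by the ideal of `𝔼`-injective morphisms. -/
abbrev CostableCat : Type u := Quotient (costableRel Q)

instance : Preadditive (StableCat Q) :=
  Quotient.preadditive (stableRel Q) (by
    intro X Y f₁ f₂ g₁ g₂ h h' A δ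
    have h1 := h A δ
    have h2 := h' A δ
    have e : (f₁ + g₁).hom - (f₂ + g₂).hom = (f₁.hom - f₂.hom) + (g₁.hom - g₂.hom) := by
      change (f₁.hom + g₁.hom) - (f₂.hom + g₂.hom) = _
      abel
    rw [e, pull_add, h1, h2, add_zero])

instance : Preadditive (CostableCat Q) :=
  Quotient.preadditive (costableRel Q) (by
    intro X Y f₁ f₂ g₁ g₂ h h' A δ
    have h1 := h A δ
    have h2 := h' A δ
    have e : (f₁ + g₁).hom - (f₂ + g₂).hom = (f₁.hom - f₂.hom) + (g₁.hom - g₂.hom) := by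
      change (f₁.hom + g₁.hom) - (f₂.hom + g₂.hom) = _
      abel
    rw [e, push_add, h1, h2, add_zero])

/-- The functor on the stable category of `Q` induced by `𝔼(-, M)`. -/
def stableExt (M : C) : (StableCat Q)ᵒᵖ ⥤ AddCommGrpCat.{v} :=
  (CategoryTheory.Quotient.lift (stableRel Q) (Q.ι.op ⋙ (E (C := C)).flip.obj M).rightOp (by
    intro X Y f g h
    refine congrArg Quiver.Hom.op ?_
    ext δ
    have := h M δ
    rw [pull_sub, sub_eq_zero] at this
    exact this)).leftOp

/-- The functor on the costable category of `Q` induced by `𝔼(M, -)`. -/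
def costableExt (M : C) : CostableCat Q ⥤ AddCommGrpCat.{v} :=
  CategoryTheory.Quotient.lift (costableRel Q) (Q.ι ⋙ (E (C := C)).obj (op M)) (by
    intro X Y f g h
    ext δ
    have := h M δ
    rw [push_sub, sub_eq_zero] at this
    exact this)

/-- `M ↦ 𝔼(-, M)`, as a functor to the functors on the stable category of `Q`. -/
def stableExtFunctor : C ⥤ ((StableCat Q)ᵒᵖ ⥤ AddCommGrpCat.{v}) where
  obj M := stableExt Q M
  map {M N} h :=
    { app := fun Y => (E.obj (op Y.unop.as.obj)).map h
      naturality := by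
        rintro ⟨Y⟩ ⟨Y'⟩ ⟨f⟩
        induction f using Quot.inductionOn with
        | h f => exact (((E (C := C)).map f.hom.op).naturality h).symm }
  map_id M := by
    ext Y : 2
    exact (E.obj (op Y.unop.as.obj)).map_id M
  map_comp f g := by
    ext Y : 2
    exact (E.obj (op Y.unop.as.obj)).map_comp f g

/-- `M ↦ 𝔼(M, -)`, as a contravariant functor to the functors on the costable category of `Q`. -/
def costableExtFunctor : Cᵒᵖ ⥤ (CostableCat Q ⥤ AddCommGrpCat.{v}) where
  obj M := costableExt Q M.unop
  map {M N} h :=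
    { app := fun Y => (E.map h).app Y.as.obj
      naturality := by
        intro Y Y' f
        induction f using Quot.inductionOn with
        | h f => exact ((E (C := C)).map h).naturality f.hom }
  map_id M := by
    ext Y : 2
    exact congrArg (fun φ => φ.app Y.as.obj) (E.map_id M)
  map_comp f g := by
    ext Y : 2
    exact congrArg (fun φ => φ.app Y.as.obj) (E.map_comp f g)

end Stable

end Extri

end

open Extri

/-!
Let `M` be an object of `P_{n+1}^∨`. A coresolution of `M` begins with a conflation `M ⟶ X ⟶ Z` whose
extension is `δ ∈ 𝔼(Z, M)`, where `X` is in `P` and `Z` is in `P_n^∨`. Dimension shifting along a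
coresolution turns the rigidity of `P` into `𝔼(P_n^∨, P) = 0` (`extVanish_vee`). The exact
sequence of the conflation therefore says that on `P_n^∨` every extension by `M` is a pullback of
`δ` and that a morphism pulls `δ` back to zero exactly if it factors through `X ⟶ Z`. In other words
`𝔼(-, M)` is the cokernel of `Hom(-, X) ⟶ Hom(-, Z)`, and this presentation passes to the stable
category (`fpRight_stableExt`).

* Full: a morphism `τ : 𝔼(-, M) ⟶ 𝔼(-, M')` is determined by `τ(δ) ∈ 𝔼(Z, M')`. Like `δ`, it pulls
  back to zero along `X ⟶ Z`, hence it is a pushout of `δ` along some `M ⟶ M'`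
  (`exists_map_eq_of_stableExt`).
* Faithful: a morphism `M ⟶ M'` which pushes `δ` out to zero extends along `M ⟶ X`, so it factors
  through an object of `P` (`exists_factor_of_stableExtFunctor_map_eq`).
* Dense: a finitely presented module is the cokernel of `Hom(-, f)` for a single `f : Y ⟶ W` in
  `P_n^∨`. Adding an `𝔼`-projective deflation `p : X ⟶ W` with `X` in `P` does not change the cokernel
  in the stable category, and makes `(f, p) : Y ⊞ X ⟶ W` a deflation (`IsDeflation.biprod_desc`). Its
  fibre `M` has the given module as `𝔼(-, M)`, and lies in `P_{n+1}^∨` by (ET4)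
  (`exists_vee_iso_of_fpRight`, `vee_succ_of_isConflation`).

Apart from the dimension shifting, only the exact sequences which involve `Hom` and `𝔼 = 𝔼¹` are
needed, and these follow directly from the axioms of a realization, (ET3) and (ET3)ᵒᵖ.
The statements about `P_{n+1}^∧` are dual and are proved by the dual arguments.
-/

namespace Extri

open ExtriangulatedCategory

attribute [local instance] hasBinaryBiproducts_of_finite_biproducts

/-! ### Exact sequences of a conflation -/

section Seq

variable {C : Type u} [Category.{v} C]

lemma seqClass_eq_of_iso {A X B B' : C} {x : A ⟶ B} {y : B ⟶ X} {x' : A ⟶ B'} {y' : B' ⟶ X}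
    (b : B ≅ B') (hx : x ≫ b.hom = x') (hy : b.hom ≫ y' = y) :
    seqClass x y = seqClass x' y' :=
  _root_.Quotient.sound ⟨b, hx, hy⟩

lemma exists_iso_of_seqClass_eq {A X B B' : C} {x : A ⟶ B} {y : B ⟶ X} {x' : A ⟶ B'}
    {y' : B' ⟶ X} (h : seqClass x y = seqClass x' y') :
    ∃ b : B ≅ B', x ≫ b.hom = x' ∧ b.hom ≫ y' = y :=
  _root_.Quotient.exact h

end Seq

section Conflations

variable {C : Type u} [Category.{v} C] [Preadditive C] [HasFiniteBiproducts C]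
  [ExtriangulatedCategory C]

lemma push_id {X A : C} (δ : Ext (E (C := C)) X A) : push (𝟙 A) δ = δ := by
  simp [push]

lemma pull_id {X A : C} (δ : Ext (E (C := C)) X A) : pull δ (𝟙 X) = δ := by
  simp [pull]

lemma exists_realization {X A : C} (δ : Ext (E (C := C)) X A) :
    ∃ (B : C) (x : A ⟶ B) (y : B ⟶ X), s δ = seqClass x y := by
  obtain ⟨⟨B, x, y⟩, h⟩ := _root_.Quotient.exists_rep (s δ)
  exact ⟨B, x, y, h.symm⟩

variable {A B X : C} {δ : Ext (E (C := C)) X A} {x : A ⟶ B} {y : B ⟶ X}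

lemma exists_lift (hδ : s δ = seqClass x y) {W : C} (c : W ⟶ X) (h : pull δ c = 0) :
    ∃ b : W ⟶ B, b ≫ y = c := by
  obtain ⟨b, -, hb⟩ := realization 0 δ _ _ x y (realization_zero W A) hδ (𝟙 A) c
    (by rw [h, map_push_zero])
  exact ⟨biprod.inr ≫ b, by rw [Category.assoc, ← hb, biprod.inr_snd_assoc]⟩

lemma exists_extension (hδ : s δ = seqClass x y) {W : C} (a : A ⟶ W) (h : push a δ = 0) :
    ∃ b : B ⟶ W, x ≫ b = a := by
  obtain ⟨b, hb, -⟩ := realization δ 0 x y _ _ hδ (realization_zero X W) a (𝟙 X)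
    (by rw [h, map_pull_zero])
  exact ⟨b ≫ biprod.fst, by rw [reassoc_of% hb, biprod.inl_fst, Category.comp_id]⟩

lemma inl_out_eq_zero (hδ : s δ = seqClass x y) : x ≫ y = 0 := by
  obtain ⟨c, -, hc⟩ := et3 0 δ _ _ x y (realization_zero A A) hδ (𝟙 A) (biprod.desc x 0) (by simp)
  simpa using (biprod.inl ≫= hc).symm

lemma pull_out_eq_zero (hδ : s δ = seqClass x y) : pull δ y = 0 := by
  obtain ⟨a, ha, -⟩ := et3_op 0 δ _ _ x y (realization_zero B A) hδ (biprod.desc x (𝟙 B)) y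
    (by ext <;> simp [inl_out_eq_zero hδ])
  rw [← ha, map_push_zero]

lemma push_inl_eq_zero (hδ : s δ = seqClass x y) : push x δ = 0 := by
  obtain ⟨c, hc, -⟩ := et3 δ 0 x y _ _ hδ (realization_zero X B) x (biprod.lift (𝟙 B) y)
    (by ext <;> simp [inl_out_eq_zero hδ])
  rw [hc, map_pull_zero]

lemma exists_push_eq (hδ : s δ = seqClass x y) {W : C} (θ : Ext (E (C := C)) X W)
    (h : pull θ y = 0) : ∃ a : A ⟶ W, push a δ = θ := by
  obtain ⟨V, i, p, hθ⟩ := exists_realization θ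
  obtain ⟨b, hb⟩ := exists_lift hθ y h
  obtain ⟨a, ha, -⟩ := et3_op δ θ x y i p hδ hθ b (𝟙 X) (by simp [hb])
  exact ⟨a, by rw [ha, pull_id]⟩

lemma exists_pull_eq (hδ : s δ = seqClass x y) {W : C} (θ : Ext (E (C := C)) W A)
    (h : push x θ = 0) : ∃ c : W ⟶ X, pull δ c = θ := by
  obtain ⟨V, i, p, hθ⟩ := exists_realization θ
  obtain ⟨b, hb⟩ := exists_extension hθ x h
  obtain ⟨c, hc, -⟩ := et3 θ δ i p x y hθ hδ (𝟙 A) b (by simp [hb])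
  exact ⟨c, by rw [← hc, push_id]⟩

/-- A conflation whose extension is zero splits. -/
lemma nonempty_iso_biprod_of_ext_eq_zero (hδ : s δ = seqClass x y) (h : δ = 0) :
    Nonempty (B ≅ A ⊞ X) := by
  subst h
  obtain ⟨b, -, -⟩ := exists_iso_of_seqClass_eq (hδ.symm.trans (realization_zero X A))
  exact ⟨b⟩

lemma ext_eq_zero_of_isZero_left (hX : IsZero X) (δ : Ext (E (C := C)) X A) : δ = 0 := by
  rw [← pull_id δ, hX.eq_of_src (𝟙 X) 0, pull_zero]

lemma ext_eq_zero_of_isZero_right (hA : IsZero A) (δ : Ext (E (C := C)) X A) : δ = 0 := by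
  rw [← push_id δ, hA.eq_of_src (𝟙 A) 0, push_zero]

lemma s_zero_eq_of_iso_isZero {A B Z : C} (f : A ≅ B) (hZ : IsZero Z) :
    s (0 : Ext (E (C := C)) Z A) = seqClass f.hom (0 : B ⟶ Z) := by
  rw [realization_zero]
  exact seqClass_eq_of_iso
    ⟨biprod.fst ≫ f.hom, f.inv ≫ biprod.inl, by ext <;> simp [hZ.eq_of_src _ 0], by simp⟩
    (by simp) (hZ.eq_of_tgt _ _)

lemma s_zero_eq_of_isZero_iso {A B Z : C} (f : A ≅ B) (hZ : IsZero Z) :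
    s (0 : Ext (E (C := C)) B Z) = seqClass (0 : Z ⟶ A) f.hom := by
  rw [realization_zero]
  exact seqClass_eq_of_iso
    ⟨biprod.snd ≫ f.inv, f.hom ≫ biprod.inr, by ext <;> simp [hZ.eq_of_src _ 0], by simp⟩
    (hZ.eq_of_src _ _) (by simp)

lemma IsConflation.biprod_map {A B X A' B' X' : C} {x : A ⟶ B} {y : B ⟶ X} {x' : A' ⟶ B'}
    {y' : B' ⟶ X'} (h : IsConflation x y) (h' : IsConflation x' y') :
    IsConflation (biprod.map x x') (biprod.map y y') := by
  obtain ⟨δ, hδ⟩ := h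
  obtain ⟨δ', hδ'⟩ := h'
  exact ⟨_, realization_sum δ δ' x y x' y' hδ hδ'⟩

/-- If `p : X ⟶ W` is a deflation, then so is `(f, p) : Y ⊞ X ⟶ W` for every `f : Y ⟶ W`:
it is the composition of `𝟙 ⊞ p` and the split epimorphism `(f, 𝟙) : Y ⊞ W ⟶ W`. -/
lemma IsDeflation.biprod_desc {X Y W : C} {p : X ⟶ W} (hp : IsDeflation p) (f : Y ⟶ W) :
    IsDeflation (biprod.desc f p) := by
  obtain ⟨K, k, hk⟩ := hp
  obtain ⟨δ, hδ⟩ := IsConflation.biprod_map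
    ⟨0, s_zero_eq_of_isZero_iso (Iso.refl Y) (isZero_zero C)⟩ hk
  have hsplit : s (0 : Ext (E (C := C)) W Y) =
      seqClass (biprod.lift (𝟙 Y) (-f)) (biprod.desc f (𝟙 W)) := by
    rw [realization_zero]
    exact seqClass_eq_of_iso
      ⟨biprod.desc (biprod.lift (𝟙 Y) (-f)) biprod.inr,
        biprod.desc (biprod.lift (𝟙 Y) f) biprod.inr, by ext <;> simp, by ext <;> simp⟩
      (by simp) (by ext <;> simp)
  obtain ⟨N, -, -, h', δ'', -, -, h, -⟩ := et4_op δ 0 _ _ _ _ hδ hsplit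
  refine ⟨N, h', δ'', ?_⟩
  convert h using 2
  ext <;> simp

/-- Dually, if `i : W ⟶ X` is an inflation, then so is `(f, i) : W ⟶ Y ⊞ X` for every
`f : W ⟶ Y`. -/
lemma IsInflation.biprod_lift {W X Y : C} {i : W ⟶ X} (hi : IsInflation i) (f : W ⟶ Y) :
    IsInflation (biprod.lift f i) := by
  obtain ⟨K, k, hk⟩ := hi
  obtain ⟨δ, hδ⟩ := IsConflation.biprod_map
    ⟨0, s_zero_eq_of_iso_isZero (Iso.refl Y) (isZero_zero C)⟩ hk
  have hsplit : s (0 : Ext (E (C := C)) Y W) =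
      seqClass (biprod.lift f (𝟙 W)) (biprod.desc (𝟙 Y) (-f)) := by
    rw [realization_zero]
    exact seqClass_eq_of_iso
      ⟨biprod.desc (biprod.lift f (𝟙 W)) biprod.inl,
        biprod.lift biprod.snd (biprod.desc (𝟙 Y) (-f)), by ext <;> simp, by ext <;> simp⟩
      (by simp) (by ext <;> simp)
  obtain ⟨N, h', -, -, δ'', -, -, h, -⟩ := et4 0 δ _ _ _ _ hsplit hδ
  refine ⟨N, h', δ'', ?_⟩
  convert h using 2
  ext <;> simp

end Conflations

/-! ### Closure properties of the classes of objects of bounded (co)resolution dimension -/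

section Closure

variable {C : Type u} [Category.{v} C] [Preadditive C] [HasFiniteBiproducts C]

lemma isClosedUnderFiniteProducts_of_biprod (Q : ObjectProperty C) [Q.ContainsZero]
    [Q.IsClosedUnderIsomorphisms] (h : ∀ X Y : C, Q X → Q Y → Q (X ⊞ Y)) :
    Q.IsClosedUnderFiniteProducts := by
  have : Q.IsClosedUnderBinaryProducts := by
    refine ⟨?_⟩
    rintro X ⟨p⟩
    refine Q.prop_of_iso ?_ (h _ _ (p.prop_diag_obj ⟨.left⟩) (p.prop_diag_obj ⟨.right⟩))
    exact (BinaryBiproduct.isLimit _ _).conePointsIsoOfNatIso p.isLimit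
      (mapPairIso (Iso.refl _) (Iso.refl _))
  exact .mk'

lemma containsZero_of_free_eq {P : ObjectProperty C} (hP : free P = P) : P.ContainsZero where
  exists_zero := by
    refine ⟨_, isZero_zero C, ?_⟩
    rw [← hP]
    refine ⟨0, Fin.elim0, fun i => i.elim0, ⟨(isZero_zero C).iso ?_⟩⟩
    rw [IsZero.iff_id_eq_zero]
    ext i
    exact i.elim0

lemma nonempty_biprod_iso_biproduct (Z : Fin 2 → C) : Nonempty (Z 0 ⊞ Z 1 ≅ ⨁ Z) := by
  refine ⟨biprod.desc (biproduct.ι Z 0) (biproduct.ι Z 1),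
    biprod.lift (biproduct.π Z 0) (biproduct.π Z 1), ?_, ?_⟩
  · ext <;> simp
  · rw [biprod.lift_desc, ← biproduct.total, Fin.sum_univ_two]

lemma prop_biprod_of_free_eq {P : ObjectProperty C} (hP : free P = P) {X Y : C} (hX : P X)
    (hY : P Y) : P (X ⊞ Y) := by
  rw [← hP]
  exact ⟨2, ![X, Y], fun i => by fin_cases i <;> assumption,
    nonempty_biprod_iso_biproduct ![X, Y]⟩

variable [ExtriangulatedCategory C] {P : ObjectProperty C}

lemma HasCoresolution.of_iso {m : ℕ} {Y Y' : C} (h : HasCoresolution P m Y) (e : Y ≅ Y') :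
    HasCoresolution P m Y' := by
  induction m generalizing Y Y' with
  | zero =>
    obtain ⟨X, hX, ⟨i⟩⟩ := h
    exact ⟨X, hX, ⟨e.symm ≪≫ i⟩⟩
  | succ m ih =>
    obtain ⟨X, Z, x, y, hX, ⟨δ, hδ⟩, hZ⟩ := h
    -- (ET4) turns `Y' ≅ Y ⟶ X` into an inflation whose cone is an extension of `Z` by `0`.
    obtain ⟨N, h', d, p, δ'', -, -, h1, h2, -, -⟩ :=
      et4 0 δ _ _ _ _ (s_zero_eq_of_iso_isZero e.symm (isZero_zero C)) hδ
    obtain ⟨b, -, -⟩ := exists_iso_of_seqClass_eq (h2.symm.trans ((congrArg s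
      (ext_eq_zero_of_isZero_right (isZero_zero C) _)).trans
        (s_zero_eq_of_isZero_iso (Iso.refl Z) (isZero_zero C))))
    exact ⟨X, N, _, h', hX, ⟨δ'', h1⟩, ih hZ b.symm⟩

lemma HasResolution.of_iso {m : ℕ} {Y Y' : C} (h : HasResolution P m Y) (e : Y ≅ Y') :
    HasResolution P m Y' := by
  induction m generalizing Y Y' with
  | zero =>
    obtain ⟨X, hX, ⟨i⟩⟩ := h
    exact ⟨X, hX, ⟨i ≪≫ e⟩⟩
  | succ m ih =>
    obtain ⟨Z, X, x, y, hX, ⟨δ, hδ⟩, hZ⟩ := h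
    obtain ⟨N, d, p, h', δ'', -, -, h1, h2, -, -⟩ :=
      et4_op δ 0 _ _ _ _ hδ (s_zero_eq_of_isZero_iso e (isZero_zero C))
    obtain ⟨b, -, -⟩ := exists_iso_of_seqClass_eq (h2.symm.trans ((congrArg s
      (ext_eq_zero_of_isZero_left (isZero_zero C) _)).trans
        (s_zero_eq_of_iso_isZero (Iso.refl Z) (isZero_zero C))))
    exact ⟨N, X, h', _, hX, ⟨δ'', h1⟩, ih hZ b.symm⟩

lemma HasCoresolution.succ (hP : free P = P) {m : ℕ} {Y : C} (h : HasCoresolution P m Y) :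
    HasCoresolution P (m + 1) Y := by
  induction m generalizing Y with
  | zero =>
    obtain ⟨X, hX, ⟨i⟩⟩ := h
    have := containsZero_of_free_eq hP
    obtain ⟨Z, hZ, hZP⟩ := P.exists_prop_of_containsZero
    exact ⟨X, Z, i.hom, 0, hX, ⟨0, s_zero_eq_of_iso_isZero i hZ⟩, Z, hZP, ⟨Iso.refl Z⟩⟩
  | succ m ih =>
    obtain ⟨X, Z, x, y, hX, hxy, hZ⟩ := h
    exact ⟨X, Z, x, y, hX, hxy, ih hZ⟩

lemma HasResolution.succ (hP : free P = P) {m : ℕ} {Y : C} (h : HasResolution P m Y) :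
    HasResolution P (m + 1) Y := by
  induction m generalizing Y with
  | zero =>
    obtain ⟨X, hX, ⟨i⟩⟩ := h
    have := containsZero_of_free_eq hP
    obtain ⟨Z, hZ, hZP⟩ := P.exists_prop_of_containsZero
    exact ⟨Z, X, 0, i.hom, hX, ⟨0, s_zero_eq_of_isZero_iso i hZ⟩, Z, hZP, ⟨Iso.refl Z⟩⟩
  | succ m ih =>
    obtain ⟨Z, X, x, y, hX, hxy, hZ⟩ := h
    exact ⟨Z, X, x, y, hX, hxy, ih hZ⟩

lemma vee_iff (hP : free P = P) (n : ℕ) (Y : C) : vee P n Y ↔ HasCoresolution P n Y := by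
  refine ⟨?_, fun h => ⟨n, le_rfl, h⟩⟩
  rintro ⟨m, hm, h⟩
  exact Nat.le_induction h (fun _ _ => HasCoresolution.succ hP) n hm

lemma wedge_iff (hP : free P = P) (n : ℕ) (Y : C) : wedge P n Y ↔ HasResolution P n Y := by
  refine ⟨?_, fun h => ⟨n, le_rfl, h⟩⟩
  rintro ⟨m, hm, h⟩
  exact Nat.le_induction h (fun _ _ => HasResolution.succ hP) n hm

lemma le_vee (n : ℕ) : P ≤ vee P n := fun X hX => ⟨0, n.zero_le, X, hX, ⟨Iso.refl X⟩⟩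

lemma le_wedge (n : ℕ) : P ≤ wedge P n := fun X hX => ⟨0, n.zero_le, X, hX, ⟨Iso.refl X⟩⟩

lemma HasCoresolution.biprod (hP : free P = P) {m : ℕ} {Y Y' : C} (h : HasCoresolution P m Y)
    (h' : HasCoresolution P m Y') : HasCoresolution P m (Y ⊞ Y') := by
  induction m generalizing Y Y' with
  | zero =>
    obtain ⟨X, hX, ⟨i⟩⟩ := h
    obtain ⟨X', hX', ⟨i'⟩⟩ := h'
    exact ⟨X ⊞ X', prop_biprod_of_free_eq hP hX hX', ⟨biprod.mapIso i i'⟩⟩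
  | succ m ih =>
    obtain ⟨X, Z, x, y, hX, hxy, hZ⟩ := h
    obtain ⟨X', Z', x', y', hX', hxy', hZ'⟩ := h'
    exact ⟨_, _, _, _, prop_biprod_of_free_eq hP hX hX', hxy.biprod_map hxy', ih hZ hZ'⟩

lemma HasResolution.biprod (hP : free P = P) {m : ℕ} {Y Y' : C} (h : HasResolution P m Y)
    (h' : HasResolution P m Y') : HasResolution P m (Y ⊞ Y') := by
  induction m generalizing Y Y' with
  | zero =>
    obtain ⟨X, hX, ⟨i⟩⟩ := h
    obtain ⟨X', hX', ⟨i'⟩⟩ := h'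
    exact ⟨X ⊞ X', prop_biprod_of_free_eq hP hX hX', ⟨biprod.mapIso i i'⟩⟩
  | succ m ih =>
    obtain ⟨Z, X, x, y, hX, hxy, hZ⟩ := h
    obtain ⟨Z', X', x', y', hX', hxy', hZ'⟩ := h'
    exact ⟨_, _, _, _, prop_biprod_of_free_eq hP hX hX', hxy.biprod_map hxy', ih hZ hZ'⟩

lemma vee_of_iso {n : ℕ} {Y Y' : C} (h : vee P n Y) (e : Y ≅ Y') : vee P n Y' := by
  obtain ⟨m, hm, h⟩ := h
  exact ⟨m, hm, h.of_iso e⟩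

lemma wedge_of_iso {n : ℕ} {Y Y' : C} (h : wedge P n Y) (e : Y ≅ Y') : wedge P n Y' := by
  obtain ⟨m, hm, h⟩ := h
  exact ⟨m, hm, h.of_iso e⟩

lemma vee_biprod (hP : free P = P) {n : ℕ} {Y Y' : C} (h : vee P n Y) (h' : vee P n Y') :
    vee P n (Y ⊞ Y') := by
  rw [vee_iff hP] at *
  exact h.biprod hP h'

lemma wedge_biprod (hP : free P = P) {n : ℕ} {Y Y' : C} (h : wedge P n Y) (h' : wedge P n Y') :
    wedge P n (Y ⊞ Y') := by
  rw [wedge_iff hP] at *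
  exact h.biprod hP h'

lemma vee_isClosedUnderFiniteProducts (hP : free P = P) (n : ℕ) :
    (vee P n).IsClosedUnderFiniteProducts := by
  have : (vee P n).ContainsZero := by
    have := containsZero_of_free_eq hP
    obtain ⟨Z, hZ, hZP⟩ := P.exists_prop_of_containsZero
    exact ⟨Z, hZ, le_vee n Z hZP⟩
  have : (vee P n).IsClosedUnderIsomorphisms := ⟨fun e h => vee_of_iso h e⟩
  exact isClosedUnderFiniteProducts_of_biprod _ fun _ _ => vee_biprod hP

lemma wedge_isClosedUnderFiniteProducts (hP : free P = P) (n : ℕ) :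
    (wedge P n).IsClosedUnderFiniteProducts := by
  have : (wedge P n).ContainsZero := by
    have := containsZero_of_free_eq hP
    obtain ⟨Z, hZ, hZP⟩ := P.exists_prop_of_containsZero
    exact ⟨Z, hZ, le_wedge n Z hZP⟩
  have : (wedge P n).IsClosedUnderIsomorphisms := ⟨fun e h => wedge_of_iso h e⟩
  exact isClosedUnderFiniteProducts_of_biprod _ fun _ _ => wedge_biprod hP

lemma exists_conflation_of_vee_succ (hP : free P = P) {n : ℕ} {M : C} (h : vee P (n + 1) M) :
    ∃ (X Z : C) (x : M ⟶ X) (y : X ⟶ Z), P X ∧ IsConflation x y ∧ vee P n Z := by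
  obtain ⟨X, Z, x, y, hX, hxy, hZ⟩ := (vee_iff hP _ _).1 h
  exact ⟨X, Z, x, y, hX, hxy, n, le_rfl, hZ⟩

lemma exists_conflation_of_wedge_succ (hP : free P = P) {n : ℕ} {M : C}
    (h : wedge P (n + 1) M) :
    ∃ (Z X : C) (x : Z ⟶ X) (y : X ⟶ M), P X ∧ IsConflation x y ∧ wedge P n Z := by
  obtain ⟨Z, X, x, y, hX, hxy, hZ⟩ := (wedge_iff hP _ _).1 h
  exact ⟨Z, X, x, y, hX, hxy, n, le_rfl, hZ⟩

/-- If `𝔼(P_n^∨, P_n^∨) = 0`, then `P_{n+1}^∨` contains the fibre of every deflation between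
objects of `P_n^∨`: by (ET4) it embeds in an object of `P` with a cone which is a split extension
of objects of `P_n^∨`. -/
lemma vee_succ_of_isConflation (hP : free P = P) {n : ℕ} (hE : ExtVanish (vee P n) (vee P n))
    {M Y W : C} {x : M ⟶ Y} {y : Y ⟶ W} (hxy : IsConflation x y) (hY : vee P n Y)
    (hW : vee P n W) : vee P (n + 1) M := by
  obtain ⟨δ, hδ⟩ := hxy
  obtain ⟨m, hm, hm'⟩ := hY
  obtain ⟨X, Z, i, p, hX, ⟨δ', hδ'⟩, hZ⟩ :=
    exists_conflation_of_vee_succ hP ⟨m, hm.trans n.le_succ, hm'⟩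
  obtain ⟨N, h', d, e, δ'', -, -, h1, h2, -, -⟩ := et4 δ δ' _ _ _ _ hδ hδ'
  obtain ⟨j⟩ := nonempty_iso_biprod_of_ext_eq_zero h2 (hE _ _ hZ hW _)
  have hN := (vee_iff hP n N).1 (vee_of_iso (vee_biprod hP hW hZ) j.symm)
  exact ⟨n + 1, le_rfl, X, N, _, h', hX, ⟨δ'', h1⟩, hN⟩

/-- The dual of `vee_succ_of_isConflation`. -/
lemma wedge_succ_of_isConflation (hP : free P = P) {n : ℕ}
    (hE : ExtVanish (wedge P n) (wedge P n)) {M Y W : C} {x : W ⟶ Y} {y : Y ⟶ M}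
    (hxy : IsConflation x y) (hY : wedge P n Y) (hW : wedge P n W) : wedge P (n + 1) M := by
  obtain ⟨δ, hδ⟩ := hxy
  obtain ⟨m, hm, hm'⟩ := hY
  obtain ⟨Z, X, i, p, hX, ⟨δ', hδ'⟩, hZ⟩ :=
    exists_conflation_of_wedge_succ hP ⟨m, hm.trans n.le_succ, hm'⟩
  obtain ⟨N, d, e, h', δ'', -, -, h1, h2, -, -⟩ := et4_op δ' δ _ _ _ _ hδ' hδ
  obtain ⟨j⟩ := nonempty_iso_biprod_of_ext_eq_zero h2 (hE _ _ hW hZ _)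
  have hN := (wedge_iff hP n N).1 (wedge_of_iso (wedge_biprod hP hZ hW) j.symm)
  exact ⟨n + 1, le_rfl, N, X, h', _, hX, ⟨δ'', h1⟩, hN⟩

end Closure

/-! ### Vanishing of extensions by dimension shifting -/

section Vanishing

variable {C : Type u} [Category.{v} C] [Preadditive C] [HasFiniteBiproducts C]
  [ExtriangulatedCategory C] {H : HigherExtensions C} {n : ℕ} {P : ObjectProperty C}

lemma HasCoresolution.ext_eq_zero (hrigid : IsRigid H n P) {k i : ℕ} (hik : i + k ≤ n) {Y A : C}
    (hY : HasCoresolution P k Y) (hA : P A) (η : Ext (H.ext i) Y A) : η = 0 := by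
  induction k generalizing i Y with
  | zero =>
    obtain ⟨X, hX, ⟨e⟩⟩ := hY
    have h : ((H.ext i).map e.inv.op).app A = 0 := by
      ext θ
      have := hrigid i hik X A hX hA (((H.ext i).map e.inv.op).app A θ)
      exact this
    have h' : 𝟙 (((H.ext i).obj (op Y)).obj A) = 0 := by
      have := congrArg (fun φ => (φ ≫ ((H.ext i).map e.hom.op).app A)) h
      simpa [← NatTrans.comp_app, ← Functor.map_comp, ← op_comp] using this
    exact congrArg (fun φ => φ.hom η) h'
  | succ k ih =>
    obtain ⟨X, Z, x, y, hX, ⟨δ, hδ⟩, hZ⟩ := hY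
    obtain ⟨θ, rfl⟩ := (H.exact_left_end δ x y hδ i A η).1 (ih (by omega) hZ _)
    rw [hrigid i (by omega) X A hX hA θ, map_zero]

lemma HasResolution.ext_eq_zero (hrigid : IsRigid H n P) {k i : ℕ} (hik : i + k ≤ n) {Y A : C}
    (hY : HasResolution P k Y) (hA : P A) (η : Ext (H.ext i) A Y) : η = 0 := by
  induction k generalizing i Y with
  | zero =>
    obtain ⟨X, hX, ⟨e⟩⟩ := hY
    have h : ((H.ext i).obj (op A)).map e.inv = 0 := by
      ext θ
      exact hrigid i hik A X hA hX _
    have h' : 𝟙 (((H.ext i).obj (op A)).obj Y) = 0 := by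
      have := congrArg (fun φ => (φ ≫ ((H.ext i).obj (op A)).map e.hom)) h
      simpa [← Functor.map_comp] using this
    exact congrArg (fun φ => φ.hom η) h'
  | succ k ih =>
    obtain ⟨Z, X, x, y, hX, ⟨δ, hδ⟩, hZ⟩ := hY
    obtain ⟨θ, rfl⟩ := (H.exact_right_end δ x y hδ i A η).1 (ih (by omega) hZ _)
    rw [hrigid i (by omega) A X hA hX θ, map_zero]

/-- `𝔼(P_n^∨, P) = 0` for an `(n+2)`-rigid class `P`. -/
lemma extVanish_vee (hrigid : IsRigid H n P) : ExtVanish (vee P n) P := by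
  rintro Y A ⟨k, hk, hY⟩ hA
  have h := fun η => hY.ext_eq_zero hrigid (i := 0) (by omega) hA η
  rw [H.ext_zero] at h
  exact h

/-- `𝔼(P, P_n^∧) = 0` for an `(n+2)`-rigid class `P`. -/
lemma extVanish_wedge (hrigid : IsRigid H n P) : ExtVanish P (wedge P n) := by
  rintro A Y hA ⟨k, hk, hY⟩
  have h := fun η => hY.ext_eq_zero hrigid (i := 0) (by omega) hA η
  rw [H.ext_zero] at h
  exact h

end Vanishing

/-! ### Presentations of modules -/

section Cokernels

variable {D : Type*} [Category* D]

lemma nonempty_isColimit_cokernelCofork_of_iso [HasZeroMorphisms D] {A B A' B' G : D} {f : A ⟶ B}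
    {p : B ⟶ G} {w : f ≫ p = 0} (h : IsColimit (CokernelCofork.ofπ p w)) (e₁ : A ≅ A')
    (e₂ : B ≅ B') {f' : A' ⟶ B'} {p' : B' ⟶ G} (hf : f ≫ e₂.hom = e₁.hom ≫ f')
    (hp : e₂.hom ≫ p' = p) :
    ∃ w' : f' ≫ p' = 0, Nonempty (IsColimit (CokernelCofork.ofπ p' w')) := by
  have hf' : f' = e₁.inv ≫ f ≫ e₂.hom := by rw [hf, e₁.inv_hom_id_assoc]
  have w' : f' ≫ p' = 0 := by simp [hf', hp, w]
  have : Epi (e₂.hom ≫ p') := hp ▸ ⟨fun a b hab => Cofork.IsColimit.hom_ext h hab⟩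
  have : Epi p' := epi_of_epi e₂.hom p'
  refine ⟨w', ⟨CokernelCofork.IsColimit.ofπ' p' w' fun {T} k hk =>
    ⟨h.desc (CokernelCofork.ofπ (e₂.hom ≫ k) (by rw [reassoc_of% hf, hk, comp_zero])), ?_⟩⟩⟩
  rw [← cancel_epi e₂.hom, reassoc_of% hp]
  exact h.fac _ WalkingParallelPair.one

/-- A cokernel of a morphism between finite coproducts of objects in the image of a full additive
functor `T` is the cokernel of the image of a single morphism. -/
lemma exists_isColimit_map_of_coproduct {A B : Type*} [Category* A] [Category* B] [Preadditive A]
    [Preadditive B] [HasFiniteBiproducts A] [HasFiniteBiproducts B] (T : A ⥤ B) [T.Additive]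
    [T.Full] {G : B} {k l : ℕ} {Y : Fin k → A} {W : Fin l → A}
    {α : (∐ fun i => T.obj (Y i)) ⟶ (∐ fun j => T.obj (W j))} {p : (∐ fun j => T.obj (W j)) ⟶ G}
    {w : α ≫ p = 0} (h : IsColimit (CokernelCofork.ofπ p w)) :
    ∃ (Y' W' : A) (f : Y' ⟶ W') (q : T.obj W' ⟶ G) (w' : T.map f ≫ q = 0),
      Nonempty (IsColimit (CokernelCofork.ofπ q w')) := by
  let e {m : ℕ} (V : Fin m → A) : (∐ fun i => T.obj (V i)) ≅ T.obj (⨁ V) :=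
    (biproduct.isoCoproduct fun i => T.obj (V i)).symm ≪≫ (T.mapBiproduct V).symm
  refine ⟨⨁ Y, ⨁ W, T.preimage ((e Y).inv ≫ α ≫ (e W).hom), (e W).inv ≫ p, ?_⟩
  exact nonempty_isColimit_cokernelCofork_of_iso h (e Y) (e W) (by simp) (by simp)

/-- Cokernels of morphisms between functors to abelian groups are recognized pointwise. -/
lemma nonempty_isColimit_cokernelCofork_of_app {F₁ F₂ G : D ⥤ AddCommGrpCat.{v}} {φ : F₁ ⟶ F₂}
    {p : F₂ ⟶ G} (w : φ ≫ p = 0) (hsurj : ∀ d, Function.Surjective (p.app d))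
    (hex : ∀ d (x : F₂.obj d), p.app d x = 0 → ∃ z : F₁.obj d, φ.app d z = x) :
    Nonempty (IsColimit (CokernelCofork.ofπ p w)) := by
  have hepi (d : D) : Epi (p.app d) := (AddCommGrpCat.epi_iff_surjective _).2 (hsurj d)
  have : Epi p := NatTrans.epi_of_epi_app p
  have hker {T : D ⥤ AddCommGrpCat.{v}} (k : F₂ ⟶ T) (hk : φ ≫ k = 0) (d : D) :
      (p.app d).hom.ker ≤ (k.app d).hom.ker := by
    intro x hx
    obtain ⟨z, rfl⟩ := hex d x hx
    exact congrArg (fun ψ => ψ.app d z) hk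
  let desc {T : D ⥤ AddCommGrpCat.{v}} (k : F₂ ⟶ T) (hk : φ ≫ k = 0) (d : D) :
      G.obj d ⟶ T.obj d :=
    AddCommGrpCat.ofHom ((p.app d).hom.liftOfSurjective (hsurj d) ⟨(k.app d).hom, hker k hk d⟩)
  have fac {T : D ⥤ AddCommGrpCat.{v}} (k : F₂ ⟶ T) (hk : φ ≫ k = 0) (d : D) :
      p.app d ≫ desc k hk d = k.app d := by
    ext x
    exact AddMonoidHom.liftOfRightInverse_comp_apply _ _
      (Function.rightInverse_surjInv (hsurj d)) ⟨(k.app d).hom, hker k hk d⟩ x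
  exact ⟨CokernelCofork.IsColimit.ofπ' p w fun {T} k hk =>
    ⟨{ app := desc k hk
       naturality := fun d d' f => by
        rw [← cancel_epi (p.app d), ← NatTrans.naturality_assoc, fac k hk, reassoc_of% fac k hk,
          NatTrans.naturality] },
      by ext d : 2; exact fac k hk d⟩⟩

end Cokernels

section Modules

variable {Z : Type u} [Category.{v} Z] [Preadditive Z]

/-- An element `g` of `G(W)` presents the right module `G`, with relations `f : Y ⟶ W`, if it
generates `G` and if its annihilator is generated by `f`. -/
lemma exists_isColimit_preadditiveYoneda (G : Zᵒᵖ ⥤ AddCommGrpCat.{v}) [G.Additive] {Y W : Z}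
    (f : Y ⟶ W) (g : G.obj (op W)) (hf : G.map f.op g = 0)
    (hgen : ∀ (V : Z) (x : G.obj (op V)), ∃ a : V ⟶ W, G.map a.op g = x)
    (hker : ∀ (V : Z) (a : V ⟶ W), G.map a.op g = 0 → ∃ b : V ⟶ Y, b ≫ f = a) :
    ∃ (p : preadditiveYoneda.obj W ⟶ G) (w : preadditiveYoneda.map f ≫ p = 0),
      Nonempty (IsColimit (CokernelCofork.ofπ p w)) := by
  have hadd (V : Z) (a b : V ⟶ W) : G.map (a + b).op g = G.map a.op g + G.map b.op g := by
    rw [op_add, G.map_add]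
    rfl
  let p : preadditiveYoneda.obj W ⟶ G :=
    { app V := AddCommGrpCat.ofHom
        (AddMonoidHom.mk' (fun a : V.unop ⟶ W => G.map a.op g) (hadd V.unop))
      naturality V V' c := by
        ext (a : V.unop ⟶ W)
        change G.map (c.unop ≫ a).op g = G.map c (G.map a.op g)
        simp }
  have w : preadditiveYoneda.map f ≫ p = 0 := by
    ext V (a : V.unop ⟶ Y)
    change G.map (a ≫ f).op g = 0
    rw [op_comp, G.map_comp, ConcreteCategory.comp_apply, hf, map_zero]
  exact ⟨p, w, nonempty_isColimit_cokernelCofork_of_app w (fun V => hgen V.unop)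
    fun V => hker V.unop⟩

/-- An element `g` of `G(W)` presents the left module `G`, with relations `f : W ⟶ Y`, if it
generates `G` and if its annihilator is generated by `f`. -/
lemma exists_isColimit_preadditiveCoyoneda (G : Z ⥤ AddCommGrpCat.{v}) [G.Additive] {Y W : Z}
    (f : W ⟶ Y) (g : G.obj W) (hf : G.map f g = 0)
    (hgen : ∀ (V : Z) (x : G.obj V), ∃ a : W ⟶ V, G.map a g = x)
    (hker : ∀ (V : Z) (a : W ⟶ V), G.map a g = 0 → ∃ b : Y ⟶ V, f ≫ b = a) :
    ∃ (p : preadditiveCoyoneda.obj (op W) ⟶ G) (w : preadditiveCoyoneda.map f.op ≫ p = 0),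
      Nonempty (IsColimit (CokernelCofork.ofπ p w)) := by
  have hadd (V : Z) (a b : W ⟶ V) : G.map (a + b) g = G.map a g + G.map b g := by
    rw [G.map_add]
    rfl
  let p : preadditiveCoyoneda.obj (op W) ⟶ G :=
    { app V := AddCommGrpCat.ofHom
        (AddMonoidHom.mk' (fun a : W ⟶ V => G.map a g) (hadd V))
      naturality V V' c := by
        ext (a : W ⟶ V)
        change G.map (a ≫ c) g = G.map c (G.map a g)
        simp }
  have w : preadditiveCoyoneda.map f.op ≫ p = 0 := by
    ext V (a : Y ⟶ V)
    change G.map (f ≫ a) g = 0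
    rw [G.map_comp, ConcreteCategory.comp_apply, hf, map_zero]
  exact ⟨p, w, nonempty_isColimit_cokernelCofork_of_app w hgen hker⟩

instance : (preadditiveYoneda : Z ⥤ Zᵒᵖ ⥤ AddCommGrpCat.{v}).Additive where
  map_add {X Y f g} := by
    ext V (a : V.unop ⟶ X)
    exact Preadditive.comp_add _ _ _ a f g

instance : (preadditiveCoyoneda : Zᵒᵖ ⥤ Z ⥤ AddCommGrpCat.{v}).Additive where
  map_add {X Y f g} := by
    ext V (a : X.unop ⟶ V)
    exact Preadditive.add_comp _ _ _ f.unop g.unop a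

lemma fpRight_of_isColimit {G : Zᵒᵖ ⥤ AddCommGrpCat.{v}} [G.Additive] {Y W : Z} {f : Y ⟶ W}
    {p : preadditiveYoneda.obj W ⟶ G} {w : preadditiveYoneda.map f ≫ p = 0}
    (h : IsColimit (CokernelCofork.ofπ p w)) : fpRight Z G := by
  let e (V : Z) : preadditiveYoneda.obj V ≅ ∐ fun _ : Fin 1 => preadditiveYoneda.obj V :=
    (coproductUniqueIso fun _ : Fin 1 => preadditiveYoneda.obj V).symm
  obtain ⟨w', h'⟩ := nonempty_isColimit_cokernelCofork_of_iso h (e Y) (e W)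
    (f' := (e Y).inv ≫ preadditiveYoneda.map f ≫ (e W).hom) (p' := (e W).inv ≫ p)
    (by simp) (by simp)
  exact ⟨inferInstance, 1, 1, fun _ => Y, fun _ => W, _, _, w', h'⟩

lemma fpLeft_of_isColimit {G : Z ⥤ AddCommGrpCat.{v}} [G.Additive] {Y W : Z} {f : W ⟶ Y}
    {p : preadditiveCoyoneda.obj (op W) ⟶ G} {w : preadditiveCoyoneda.map f.op ≫ p = 0}
    (h : IsColimit (CokernelCofork.ofπ p w)) : fpLeft Z G := by
  let e (V : Z) :
      preadditiveCoyoneda.obj (op V) ≅ ∐ fun _ : Fin 1 => preadditiveCoyoneda.obj (op V) :=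
    (coproductUniqueIso fun _ : Fin 1 => preadditiveCoyoneda.obj (op V)).symm
  obtain ⟨w', h'⟩ := nonempty_isColimit_cokernelCofork_of_iso h (e Y) (e W)
    (f' := (e Y).inv ≫ preadditiveCoyoneda.map f.op ≫ (e W).hom) (p' := (e W).inv ≫ p)
    (by simp) (by simp)
  exact ⟨inferInstance, 1, 1, fun _ => Y, fun _ => W, _, _, w', h'⟩

lemma fpRight.exists_presentation [HasFiniteBiproducts Z] {G : Zᵒᵖ ⥤ AddCommGrpCat.{v}}
    (hG : fpRight Z G) :
    ∃ (Y W : Z) (f : Y ⟶ W) (p : preadditiveYoneda.obj W ⟶ G)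
      (w : preadditiveYoneda.map f ≫ p = 0), Nonempty (IsColimit (CokernelCofork.ofπ p w)) := by
  obtain ⟨-, k, l, Y, W, α, p, w, ⟨h⟩⟩ := hG
  have : HasFiniteBiproducts (Zᵒᵖ ⥤ AddCommGrpCat.{v}) := .of_hasFiniteProducts
  exact exists_isColimit_map_of_coproduct preadditiveYoneda h

lemma fpLeft.exists_presentation [HasFiniteBiproducts Z] {G : Z ⥤ AddCommGrpCat.{v}}
    (hG : fpLeft Z G) :
    ∃ (Y W : Z) (f : W ⟶ Y) (p : preadditiveCoyoneda.obj (op W) ⟶ G)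
      (w : preadditiveCoyoneda.map f.op ≫ p = 0),
      Nonempty (IsColimit (CokernelCofork.ofπ p w)) := by
  obtain ⟨-, k, l, Y, W, α, p, w, ⟨h⟩⟩ := hG
  have : HasFiniteBiproducts (Z ⥤ AddCommGrpCat.{v}) := .of_hasFiniteProducts
  have : HasFiniteBiproducts Zᵒᵖ := .of_hasFiniteProducts
  obtain ⟨Y', W', f, q, w', h'⟩ := exists_isColimit_map_of_coproduct preadditiveCoyoneda
    (Y := fun i => op (Y i)) (W := fun i => op (W i)) h
  exact ⟨Y'.unop, W'.unop, f.unop, q, w', h'⟩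

end Modules

/-! ### The functors `𝔼(-, M)` and `𝔼(M, -)` on the stable and costable categories -/

section StableModules

variable {C : Type u} [Category.{v} C] [Preadditive C] [HasFiniteBiproducts C]
  [ExtriangulatedCategory C] (Q : ObjectProperty C)

instance : (Quotient.functor (stableRel Q)).Additive where
  map_add := rfl

instance : (Quotient.functor (costableRel Q)).Additive where
  map_add := rfl

lemma hasFiniteBiproducts_stableCat [Q.IsClosedUnderFiniteProducts] :
    HasFiniteBiproducts (StableCat Q) := by
  have : HasFiniteBiproducts Q.FullSubcategory := .of_hasFiniteProducts
  exact ⟨fun _ => ⟨fun Y =>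
    (Quotient.functor (stableRel Q)).hasBiproduct_of_preserves fun j => (Y j).as⟩⟩

lemma hasFiniteBiproducts_costableCat [Q.IsClosedUnderFiniteProducts] :
    HasFiniteBiproducts (CostableCat Q) := by
  have : HasFiniteBiproducts Q.FullSubcategory := .of_hasFiniteProducts
  exact ⟨fun _ => ⟨fun Y =>
    (Quotient.functor (costableRel Q)).hasBiproduct_of_preserves fun j => (Y j).as⟩⟩

instance (M : C) : (stableExt Q M).Additive where
  map_add {Y Y' f g} := by
    obtain ⟨f⟩ := f
    obtain ⟨g⟩ := g
    induction f using Quot.inductionOn with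
    | h f =>
      induction g using Quot.inductionOn with
      | h g =>
        ext θ
        exact pull_add θ f.hom g.hom

instance (M : C) : (costableExt Q M).Additive where
  map_add {Y Y' f g} := by
    induction f using Quot.inductionOn with
    | h f =>
      induction g using Quot.inductionOn with
      | h g =>
        ext θ
        exact push_add θ f.hom g.hom

variable {Q}

/-- An extension `δ ∈ 𝔼(W, M)` presents the module `𝔼(-, M)` with relations `f : Y ⟶ W`, if every
extension is a pullback of `δ` and the morphisms which pull `δ` back to zero factor through `f`
up to `𝔼`-projective morphisms. -/
lemma exists_isColimit_stableExt {M Y W : C} (hY : Q Y) (hW : Q W) (f : Y ⟶ W)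
    (δ : Ext (E (C := C)) W M) (hf : pull δ f = 0)
    (hgen : ∀ (V : C) (_ : Q V) (θ : Ext (E (C := C)) V M), ∃ a : V ⟶ W, pull δ a = θ)
    (hker : ∀ (V : C) (_ : Q V) (a : V ⟶ W), pull δ a = 0 →
      ∃ b : V ⟶ Y, IsProjMor (b ≫ f - a)) :
    ∃ (p : preadditiveYoneda.obj ((Quotient.functor (stableRel Q)).obj ⟨W, hW⟩) ⟶ stableExt Q M)
      (w : preadditiveYoneda.map ((Quotient.functor (stableRel Q)).map
        (ObjectProperty.homMk f : (⟨Y, hY⟩ : Q.FullSubcategory) ⟶ ⟨W, hW⟩)) ≫ p = 0),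
      Nonempty (IsColimit (CokernelCofork.ofπ p w)) := by
  refine exists_isColimit_preadditiveYoneda (stableExt Q M) _ δ hf ?_ ?_
  · intro V θ
    obtain ⟨a, ha⟩ := hgen V.as.obj V.as.property θ
    exact ⟨(Quotient.functor (stableRel Q)).map (ObjectProperty.homMk a), ha⟩
  · intro V a ha
    induction a using Quot.inductionOn with
    | h a =>
      obtain ⟨b, hb⟩ := hker V.as.obj V.as.property a.hom ha
      exact ⟨(Quotient.functor (stableRel Q)).map (ObjectProperty.homMk b),
        CategoryTheory.Quotient.sound (stableRel Q) hb⟩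

/-- An extension `δ ∈ 𝔼(M, W)` presents the module `𝔼(M, -)` with relations `f : W ⟶ Y`, if every
extension is a pushout of `δ` and the morphisms which push `δ` out to zero factor through `f`
up to `𝔼`-injective morphisms. -/
lemma exists_isColimit_costableExt {M Y W : C} (hY : Q Y) (hW : Q W) (f : W ⟶ Y)
    (δ : Ext (E (C := C)) M W) (hf : push f δ = 0)
    (hgen : ∀ (V : C) (_ : Q V) (θ : Ext (E (C := C)) M V), ∃ a : W ⟶ V, push a δ = θ)
    (hker : ∀ (V : C) (_ : Q V) (a : W ⟶ V), push a δ = 0 →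
      ∃ b : Y ⟶ V, IsInjMor (f ≫ b - a)) :
    ∃ (p : preadditiveCoyoneda.obj (op ((Quotient.functor (costableRel Q)).obj ⟨W, hW⟩)) ⟶
        costableExt Q M)
      (w : preadditiveCoyoneda.map ((Quotient.functor (costableRel Q)).map
        (ObjectProperty.homMk f : (⟨W, hW⟩ : Q.FullSubcategory) ⟶ ⟨Y, hY⟩)).op ≫ p = 0),
      Nonempty (IsColimit (CokernelCofork.ofπ p w)) := by
  refine exists_isColimit_preadditiveCoyoneda (costableExt Q M) _ δ hf ?_ ?_
  · intro V θ
    obtain ⟨a, ha⟩ := hgen V.as.obj V.as.property θ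
    exact ⟨(Quotient.functor (costableRel Q)).map (ObjectProperty.homMk a), ha⟩
  · intro V a ha
    induction a using Quot.inductionOn with
    | h a =>
      obtain ⟨b, hb⟩ := hker V.as.obj V.as.property a.hom ha
      exact ⟨(Quotient.functor (costableRel Q)).map (ObjectProperty.homMk b),
        CategoryTheory.Quotient.sound (costableRel Q) hb⟩

lemma isProjMor_zero (X Y : C) : IsProjMor (0 : X ⟶ Y) := fun _ δ => pull_zero δ

lemma isInjMor_zero (X Y : C) : IsInjMor (0 : X ⟶ Y) := fun _ δ => push_zero δ

/-- If `M ⟶ Y ⟶ W` is a conflation with `Y` and `W` in `Q` and `𝔼(Q, Y) = 0`, then `𝔼(-, M)` is the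
cokernel of `Hom(-, Y) ⟶ Hom(-, W)`. -/
lemma fpRight_stableExt {M Y W : C} {x : M ⟶ Y} {y : Y ⟶ W} (hxy : IsConflation x y) (hY : Q Y)
    (hW : Q W) (hE : ∀ (V : C) (_ : Q V) (θ : Ext (E (C := C)) V Y), θ = 0) :
    fpRight (StableCat Q) (stableExt Q M) := by
  obtain ⟨δ, hδ⟩ := hxy
  obtain ⟨p, w, ⟨h⟩⟩ := exists_isColimit_stableExt hY hW y δ (pull_out_eq_zero hδ)
    (fun V hV θ => exists_pull_eq hδ θ (hE V hV _)) fun V hV a ha => by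
      obtain ⟨b, rfl⟩ := exists_lift hδ a ha
      exact ⟨b, by rw [sub_self]; exact isProjMor_zero _ _⟩
  exact fpRight_of_isColimit h

/-- If `W ⟶ Y ⟶ M` is a conflation with `Y` and `W` in `Q` and `𝔼(Y, Q) = 0`, then `𝔼(M, -)` is the
cokernel of `Hom(Y, -) ⟶ Hom(W, -)`. -/
lemma fpLeft_costableExt {M Y W : C} {x : W ⟶ Y} {y : Y ⟶ M} (hxy : IsConflation x y) (hY : Q Y)
    (hW : Q W) (hE : ∀ (V : C) (_ : Q V) (θ : Ext (E (C := C)) Y V), θ = 0) :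
    fpLeft (CostableCat Q) (costableExt Q M) := by
  obtain ⟨δ, hδ⟩ := hxy
  obtain ⟨p, w, ⟨h⟩⟩ := exists_isColimit_costableExt hY hW x δ (push_inl_eq_zero hδ)
    (fun V hV θ => exists_push_eq hδ θ (hE V hV _)) fun V hV a ha => by
      obtain ⟨b, rfl⟩ := exists_extension hδ a ha
      exact ⟨b, by rw [sub_self]; exact isInjMor_zero _ _⟩
  exact fpLeft_of_isColimit h

/-- Since `𝔼(-, M)` is generated by `δ ∈ 𝔼(W, M)`, a morphism `τ : 𝔼(-, M) ⟶ 𝔼(-, M')` is determined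
by `τ(δ)`; the latter pulls back to zero along `Y ⟶ W`, hence is a pushout of `δ`. -/
lemma exists_map_eq_of_stableExt {M M' Y W : C} {x : M ⟶ Y} {y : Y ⟶ W} (hxy : IsConflation x y)
    (hY : Q Y) (hW : Q W) (hE : ∀ (V : C) (_ : Q V) (θ : Ext (E (C := C)) V Y), θ = 0)
    (τ : stableExt Q M ⟶ stableExt Q M') :
    ∃ a : M ⟶ M', (stableExtFunctor Q).map a = τ := by
  obtain ⟨δ, hδ⟩ := hxy
  let t (V : C) (hV : Q V) : Ext (E (C := C)) V M → Ext (E (C := C)) V M' :=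
    fun θ => τ.app (op ((Quotient.functor (stableRel Q)).obj ⟨V, hV⟩)) θ
  have ht {V V' : C} (hV : Q V) (hV' : Q V') (c : V' ⟶ V) (θ : Ext (E (C := C)) V M) :
      t V' hV' (pull θ c) = pull (t V hV θ) c :=
    congrArg (fun φ => φ θ) (τ.naturality ((Quotient.functor (stableRel Q)).map
      (ObjectProperty.homMk c : (⟨V', hV'⟩ : Q.FullSubcategory) ⟶ ⟨V, hV⟩)).op)
  have ht0 : t Y hY 0 = 0 := map_zero (τ.app _).hom
  obtain ⟨a, ha⟩ := exists_push_eq hδ (t W hW δ) (by rw [← ht hW hY, pull_out_eq_zero hδ, ht0])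
  refine ⟨a, ?_⟩
  ext V θ
  obtain ⟨c, rfl⟩ := exists_pull_eq hδ θ (hE _ V.unop.as.property _)
  exact (push_pull δ c a).trans ((congrArg (pull · c) ha).trans
    (ht hW V.unop.as.property c δ).symm)

/-- The dual of `exists_map_eq_of_stableExt`. -/
lemma exists_map_eq_of_costableExt {M M' Y W : C} {x : W ⟶ Y} {y : Y ⟶ M}
    (hxy : IsConflation x y) (hY : Q Y) (hW : Q W)
    (hE : ∀ (V : C) (_ : Q V) (θ : Ext (E (C := C)) Y V), θ = 0)
    (τ : costableExt Q M ⟶ costableExt Q M') :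
    ∃ a : M' ⟶ M, (costableExtFunctor Q).map a.op = τ := by
  obtain ⟨δ, hδ⟩ := hxy
  let t (V : C) (hV : Q V) : Ext (E (C := C)) M V → Ext (E (C := C)) M' V :=
    fun θ => τ.app ((Quotient.functor (costableRel Q)).obj ⟨V, hV⟩) θ
  have ht {V V' : C} (hV : Q V) (hV' : Q V') (c : V ⟶ V') (θ : Ext (E (C := C)) M V) :
      t V' hV' (push c θ) = push c (t V hV θ) :=
    congrArg (fun φ => φ θ) (τ.naturality ((Quotient.functor (costableRel Q)).map
      (ObjectProperty.homMk c : (⟨V, hV⟩ : Q.FullSubcategory) ⟶ ⟨V', hV'⟩)))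
  have ht0 : t Y hY 0 = 0 := map_zero (τ.app _).hom
  obtain ⟨a, ha⟩ := exists_pull_eq hδ (t W hW δ) (by rw [← ht hW hY, push_inl_eq_zero hδ, ht0])
  refine ⟨a, ?_⟩
  ext V θ
  obtain ⟨c, rfl⟩ := exists_push_eq hδ θ (hE _ V.as.property _)
  exact (push_pull δ a c).symm.trans ((congrArg (push c ·) ha).trans
    (ht hW V.as.property c δ).symm)

lemma exists_factor_of_stableExtFunctor_map_eq {M M' Y W : C} {x : M ⟶ Y} {y : Y ⟶ W}
    (hxy : IsConflation x y) (hW : Q W) {a b : M ⟶ M'}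
    (h : (stableExtFunctor Q).map a = (stableExtFunctor Q).map b) :
    ∃ c : Y ⟶ M', a - b = x ≫ c := by
  obtain ⟨δ, hδ⟩ := hxy
  have hab : push a δ = push b δ := congrArg
    (fun φ : stableExt Q M ⟶ stableExt Q M' =>
      φ.app (op ((Quotient.functor (stableRel Q)).obj ⟨W, hW⟩)) δ) h
  obtain ⟨c, hc⟩ := exists_extension hδ (a - b) (by rw [push_sub, hab, sub_self])
  exact ⟨c, hc.symm⟩

lemma exists_factor_of_costableExtFunctor_map_eq {M M' Y W : C} {x : W ⟶ Y} {y : Y ⟶ M}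
    (hxy : IsConflation x y) (hW : Q W) {a b : M' ⟶ M}
    (h : (costableExtFunctor Q).map a.op = (costableExtFunctor Q).map b.op) :
    ∃ c : M' ⟶ Y, a - b = c ≫ y := by
  obtain ⟨δ, hδ⟩ := hxy
  have hab : pull δ a = pull δ b := congrArg
    (fun φ : costableExt Q M ⟶ costableExt Q M' =>
      φ.app ((Quotient.functor (costableRel Q)).obj ⟨W, hW⟩) δ) h
  obtain ⟨c, hc⟩ := exists_lift hδ (a - b) (by rw [pull_sub, hab, sub_self])
  exact ⟨c, hc.symm⟩

lemma stableExtFunctor_map_eq_of_factor {M M' X : C}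
    (hE : ∀ (V : C) (_ : Q V) (θ : Ext (E (C := C)) V X), θ = 0) {a b : M ⟶ M'} (x : M ⟶ X)
    (c : X ⟶ M') (h : a - b = x ≫ c) :
    (stableExtFunctor Q).map a = (stableExtFunctor Q).map b := by
  have key (V : C) (hV : Q V) (θ : Ext (E (C := C)) V M) : push a θ = push b θ := by
    rw [← sub_eq_zero, ← push_sub, h, push_comp, hE V hV (push x θ), map_push_zero]
  ext V θ
  exact key _ V.unop.as.property θ

lemma costableExtFunctor_map_eq_of_factor {M M' X : C}
    (hE : ∀ (V : C) (_ : Q V) (θ : Ext (E (C := C)) X V), θ = 0) {a b : M' ⟶ M} (x : M' ⟶ X)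
    (c : X ⟶ M) (h : a - b = x ≫ c) :
    (costableExtFunctor Q).map a.op = (costableExtFunctor Q).map b.op := by
  have key (V : C) (hV : Q V) (θ : Ext (E (C := C)) M V) : pull θ a = pull θ b := by
    rw [← sub_eq_zero, ← pull_sub, h, pull_comp, hE V hV (pull θ c), map_pull_zero]
  ext V θ
  exact key _ V.as.property θ

end StableModules

/-! ### Density -/

section Density

variable {C : Type u} [Category.{v} C] [Preadditive C] [HasFiniteBiproducts C]
  [ExtriangulatedCategory C] {P : ObjectProperty C} {n : ℕ}

/-- Let `G` be the cokernel of `Hom(-, f)` with `f : Y ⟶ W`, and let `p : X ⟶ W` be an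
`𝔼`-projective deflation with `X` in `P`. The fibre `M` of the deflation `(f, p) : Y ⊞ X ⟶ W`
satisfies `𝔼(-, M) ≅ G`, because `p` vanishes in the stable category. -/
lemma exists_vee_iso_of_fpRight (hP : free P = P) (hproj : EnoughProjMor (vee P n) P)
    (hE : ExtVanish (vee P n) (vee P n)) {G : (StableCat (vee P n))ᵒᵖ ⥤ AddCommGrpCat.{v}}
    (hG : fpRight _ G) :
    ∃ M : C, vee P (n + 1) M ∧ Nonempty (stableExt (vee P n) M ≅ G) := by
  have := vee_isClosedUnderFiniteProducts hP n
  have := hasFiniteBiproducts_stableCat (vee P n)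
  obtain ⟨⟨⟨Y, hY⟩⟩, ⟨⟨W, hW⟩⟩, f, q, w, ⟨hq⟩⟩ := hG.exists_presentation
  obtain ⟨⟨f⟩, rfl⟩ := (Quotient.functor (stableRel (vee P n))).map_surjective f
  obtain ⟨X, p, hX, hp, hp'⟩ := hproj W hW
  obtain ⟨M, x, δ, hδ⟩ := hp.biprod_desc f
  have hYX : vee P n (Y ⊞ X) := vee_biprod hP hY (le_vee n X hX)
  obtain ⟨q', w', ⟨hq'⟩⟩ := exists_isColimit_stableExt hY hW f δ
    (by rw [← biprod.inl_desc f p, pull_comp, pull_out_eq_zero hδ, map_pull_zero])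
    (fun V hV θ => exists_pull_eq hδ θ (hE V _ hV hYX _)) fun V hV a ha => by
      obtain ⟨b, rfl⟩ := exists_lift hδ a ha
      refine ⟨b ≫ biprod.fst, fun A θ => ?_⟩
      have : (b ≫ biprod.fst) ≫ f - b ≫ biprod.desc f p = (-(b ≫ biprod.snd)) ≫ p := by
        rw [biprod.desc_eq]
        simp
      rw [this, pull_comp, hp', map_pull_zero]
  exact ⟨M, vee_succ_of_isConflation hP hE ⟨δ, hδ⟩ hYX hW, ⟨hq'.coconePointUniqueUpToIso hq⟩⟩

/-- The dual of `exists_vee_iso_of_fpRight`. -/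
lemma exists_wedge_iso_of_fpLeft (hP : free P = P) (hinj : EnoughInjMor (wedge P n) P)
    (hE : ExtVanish (wedge P n) (wedge P n)) {G : CostableCat (wedge P n) ⥤ AddCommGrpCat.{v}}
    (hG : fpLeft _ G) :
    ∃ M : C, wedge P (n + 1) M ∧ Nonempty (costableExt (wedge P n) M ≅ G) := by
  have := wedge_isClosedUnderFiniteProducts hP n
  have := hasFiniteBiproducts_costableCat (wedge P n)
  obtain ⟨⟨⟨Y, hY⟩⟩, ⟨⟨W, hW⟩⟩, f, q, w, ⟨hq⟩⟩ := hG.exists_presentation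
  obtain ⟨⟨f⟩, rfl⟩ := (Quotient.functor (costableRel (wedge P n))).map_surjective f
  obtain ⟨X, i, hX, hi, hi'⟩ := hinj W hW
  obtain ⟨M, y, δ, hδ⟩ := hi.biprod_lift f
  have hYX : wedge P n (Y ⊞ X) := wedge_biprod hP hY (le_wedge n X hX)
  obtain ⟨q', w', ⟨hq'⟩⟩ := exists_isColimit_costableExt hY hW f δ
    (by rw [← biprod.lift_fst f i, push_comp, push_inl_eq_zero hδ, map_push_zero])
    (fun V hV θ => exists_push_eq hδ θ (hE _ V hYX hV _)) fun V hV a ha => by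
      obtain ⟨b, rfl⟩ := exists_extension hδ a ha
      refine ⟨biprod.inl ≫ b, fun A θ => ?_⟩
      have : f ≫ biprod.inl ≫ b - biprod.lift f i ≫ b = i ≫ (-(biprod.inr ≫ b)) := by
        rw [biprod.lift_eq]
        simp
      rw [this, push_comp, hi', map_push_zero]
  exact ⟨M, wedge_succ_of_isConflation hP hE ⟨δ, hδ⟩ hYX hW, ⟨hq'.coconePointUniqueUpToIso hq⟩⟩

end Density

end Extri

/-! ### The equivalences -/

theorem mainTheorem3 {C : Type u} [Category.{v} C] [Preadditive C] [HasFiniteBiproducts C]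
    [ExtriangulatedCategory C] (H : HigherExtensions C) (n : ℕ) (P : ObjectProperty C)
    (hfree : free P = P) (hrigid : IsRigid H n P) :
    (∃ F : CategoryTheory.Quotient (factorRel (vee P (n + 1)) P) ⥤
        (fpRight (StableCat (vee P n))).FullSubcategory,
      CategoryTheory.Quotient.functor (factorRel (vee P (n + 1)) P) ⋙ F ⋙
          (fpRight (StableCat (vee P n))).ι =
        (vee P (n + 1)).ι ⋙ stableExtFunctor (vee P n) ∧
      F.Full ∧ F.Faithful ∧
      (EnoughProjMor (vee P n) P → ExtVanish (vee P n) (vee P n) → F.IsEquivalence)) ∧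
    (∃ K : (CategoryTheory.Quotient (factorRel (wedge P (n + 1)) P))ᵒᵖ ⥤
        (fpLeft (CostableCat (wedge P n))).FullSubcategory,
      (CategoryTheory.Quotient.functor (factorRel (wedge P (n + 1)) P)).op ⋙ K ⋙
          (fpLeft (CostableCat (wedge P n))).ι =
        (wedge P (n + 1)).ι.op ⋙ costableExtFunctor (wedge P n) ∧
      K.Full ∧ K.Faithful ∧
      (EnoughInjMor (wedge P n) P → ExtVanish (wedge P n) (wedge P n) → K.IsEquivalence)) := by
  have hvee := extVanish_vee hrigid
  have hwedge := extVanish_wedge hrigid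
  constructor
  · let S := (vee P (n + 1)).ι ⋙ stableExtFunctor (vee P n)
    have hS (M) : fpRight (StableCat (vee P n)) (S.obj M) := by
      obtain ⟨X, Z, x, y, hX, hxy, hZ⟩ := exists_conflation_of_vee_succ hfree M.property
      exact fpRight_stableExt hxy (le_vee n X hX) hZ fun V hV => hvee V X hV hX
    let F := CategoryTheory.Quotient.lift (factorRel (vee P (n + 1)) P)
      ((fpRight (StableCat (vee P n))).lift S hS) fun M N f g ⟨X, a, b, hX, h⟩ => by
        apply ObjectProperty.hom_ext
        exact stableExtFunctor_map_eq_of_factor (fun V hV => hvee V X hV hX) a b h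
    have hfull : F.Full := ⟨fun {M N} τ => by
      obtain ⟨X, Z, x, y, hX, hxy, hZ⟩ := exists_conflation_of_vee_succ hfree M.as.property
      obtain ⟨a, ha⟩ := exists_map_eq_of_stableExt hxy (le_vee n X hX) hZ
        (fun V hV => hvee V X hV hX) τ.hom
      exact ⟨(CategoryTheory.Quotient.functor _).map (ObjectProperty.homMk a),
        ObjectProperty.hom_ext _ ha⟩⟩
    have hfaithful : F.Faithful := ⟨fun {M N} f g hfg => by
      obtain ⟨f, rfl⟩ := (CategoryTheory.Quotient.functor _).map_surjective f
      obtain ⟨g, rfl⟩ := (CategoryTheory.Quotient.functor _).map_surjective g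
      obtain ⟨X, Z, x, y, hX, hxy, hZ⟩ := exists_conflation_of_vee_succ hfree M.as.property
      obtain ⟨c, hc⟩ := exists_factor_of_stableExtFunctor_map_eq hxy hZ
        (congrArg (fun φ => φ.hom) hfg)
      exact CategoryTheory.Quotient.sound _ ⟨X, x, c, hX, hc⟩⟩
    refine ⟨F, rfl, hfull, hfaithful, fun hproj hE => ?_⟩
    have : F.EssSurj := ⟨fun G => by
      obtain ⟨M, hM, ⟨e⟩⟩ := exists_vee_iso_of_fpRight hfree hproj hE G.property
      exact ⟨⟨⟨M, hM⟩⟩, ⟨ObjectProperty.isoMk _ e⟩⟩⟩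
    exact {}
  · let S := (wedge P (n + 1)).ι.op ⋙ costableExtFunctor (wedge P n)
    have hS (M) : fpLeft (CostableCat (wedge P n)) (S.obj M) := by
      obtain ⟨Z, X, x, y, hX, hxy, hZ⟩ := exists_conflation_of_wedge_succ hfree M.unop.property
      exact fpLeft_costableExt hxy (le_wedge n X hX) hZ fun V hV => hwedge X V hX hV
    let K := (CategoryTheory.Quotient.lift (factorRel (wedge P (n + 1)) P)
      ((fpLeft (CostableCat (wedge P n))).lift S hS).rightOp fun M N f g ⟨X, a, b, hX, h⟩ => by
        apply Quiver.Hom.unop_inj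
        apply ObjectProperty.hom_ext
        exact costableExtFunctor_map_eq_of_factor (fun V hV => hwedge X V hX hV) a b h).leftOp
    have hfull : K.Full := ⟨fun {M N} τ => by
      obtain ⟨Z, X, x, y, hX, hxy, hZ⟩ :=
        exists_conflation_of_wedge_succ hfree M.unop.as.property
      obtain ⟨a, ha⟩ := exists_map_eq_of_costableExt hxy (le_wedge n X hX) hZ
        (fun V hV => hwedge X V hX hV) τ.hom
      exact ⟨((CategoryTheory.Quotient.functor _).map (ObjectProperty.homMk a)).op,
        ObjectProperty.hom_ext _ ha⟩⟩
    have hfaithful : K.Faithful := ⟨fun {M N} f g hfg => by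
      obtain ⟨f⟩ := f
      obtain ⟨g⟩ := g
      obtain ⟨f, rfl⟩ := (CategoryTheory.Quotient.functor _).map_surjective f
      obtain ⟨g, rfl⟩ := (CategoryTheory.Quotient.functor _).map_surjective g
      obtain ⟨Z, X, x, y, hX, hxy, hZ⟩ :=
        exists_conflation_of_wedge_succ hfree M.unop.as.property
      obtain ⟨c, hc⟩ := exists_factor_of_costableExtFunctor_map_eq hxy hZ
        (congrArg (fun φ => φ.hom) hfg)
      exact congrArg Quiver.Hom.op (CategoryTheory.Quotient.sound _ ⟨X, c, y, hX, hc⟩)⟩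
    refine ⟨K, rfl, hfull, hfaithful, fun hinj hE => ?_⟩
    have : K.EssSurj := ⟨fun G => by
      obtain ⟨M, hM, ⟨e⟩⟩ := exists_wedge_iso_of_fpLeft hfree hinj hE G.property
      exact ⟨op ⟨⟨M, hM⟩⟩, ⟨ObjectProperty.isoMk _ e⟩⟩⟩
    exact {}
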